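/- \textbf{Notation.} For $x\in\mathbb R^n$, $\|x\|_0$ is the number of nonzero entries, and $x$ is $k$-sparse if $\|x\|_0\le k$. A matrix $M\in\mathbb R^{N\times n}$ is $(b,b',\eta,\tau)$-\emph{erasure-robust} if for every $B\subseteq[N]$ with $|B|\le b$ there is $C\subseteq[n]$ with $|C|\le b'$ such that every $x\in\mathbb R^n$ satisfies $\|x\|_0\ge\tau$ or $\|x_{C^c}\|_2\le\eta\,\|M_{B^c}x\|_\infty$ (subscripts denote restriction to the indexed entries, respectively rows). For an invertible $S\in\mathbb R^{n\times n}$, samples $X\in\mathbb R^{m\times n}$ and a signal $w^*\in\mathbb R^n$, the $S$-\emph{preconditioned Lasso fails} if some $w\in\mathbb R^n$ with $Xw=Xw^*$ has $\|S^Tw\|_1<\|S^Tw^*\|_1$, i.e. $w^*$ is not a minimizer (in particular not the unique minimizer) of $\|S^Tw\|_1$ subject to $Xw=Xw^*$. \textbf{Theorem.} There is an absolute constant $c>0$ such that the following holds. Let $r\le n$ be natural numbers, $M\in\mathbb R^{(n-r)\times n}$ a matrix with rows $M_1,\dots,M_{n-r}$, $\epsilon>0$, $\Theta=M^TM$, $\Sigma=(\Theta+\epsilon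 I)^{-1}$, and let $\lambda$ be the smallest nonzero eigenvalue of $\Theta$ (assumed to exist, i.e. $M\ne0$). Let $k,m,t$ be positive integers and $\tau,\eta,b,b'>0$ real numbers. Suppose that $M$ is $(b,b',\eta,\tau)$-erasure-robust, that every row of $M$ is $k$-sparse, and that $$k>2\frac n\tau\log n,\qquad r-b'\ge 3m,\qquad 9\,n^{105/2}\,\eta\,\|M\|_F\sqrt{\epsilon/\lambda}<1.$$ Then there is a probability distribution $\mathcal D$ on $k(t+1)$-sparse signals in $\mathbb R^n$ with the following property. For every real $\ell\in[1,50]$ with $k\ge(\ell+1)\frac n\tau\log n$ and every invertible $S\in\mathbb R^{n\times n}$, with probability at least $$1-\exp\!\left(-\frac{tb}{n-r}\right)-n^{-\ell}$$ over $w^*\sim\mathcal D$, the $S$-preconditioned Lasso fails with probability at least $1-\exp(-cm)$ over independent samples $X_1,\dots,X_m\sim N(0,\Sigma)$. (The case $\ell=1$ is always available; if $k\ge 51\frac n\tau\log n$, the error term is $n^{-50}$.) Moreover, if $k\le n$ and $t\le n$, then $\mathcal D$ can be taken to be the law of $$w^*=Z_0\sqrt\epsilon\,\tilde w+\sum_{i=1}^t\frac{Z_i\,M_{R_i}}{\sqrt{M_{R_i}^T\Sigma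 M_{R_i}}},$$ where $R_1,\dots,R_t$ are uniform on $[n-r]$, $Z_0,\dots,Z_t$ are uniform on $[-1,1]$, $\tilde w$ has uniformly random support of size $k$ with entries on it uniform on $[-1,1]$, everything is independent, and a zero row $M_{R_i}$ contributes $0$ to the sum. -/

import Mathlib

open MeasureTheory ProbabilityTheory Matrix
open scoped ENNReal

noncomputable section

namespace PrecondLasso

/-- The number of nonzero entries of a vector. -/
def nnz {n : ℕ} (x : Fin n → ℝ) : ℕ :=
  (Finset.univ.filter (fun i => x i ≠ 0)).card

/-- The `ℓ₁` norm of a vector. -/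
def l1Norm {n : ℕ} (x : Fin n → ℝ) : ℝ := ∑ i, |x i|

/-- The Frobenius norm of a matrix. -/
def frobNorm {N n : ℕ} (M : Matrix (Fin N) (Fin n) ℝ) : ℝ :=
  Real.sqrt (∑ i, ∑ j, M i j ^ 2)

/-- `(b, b', η, τ)`-erasure-robustness: for every set `B` of at most `b` rows there is a set `C` of
at most `b'` coordinates such that every `x` has at least `τ` nonzero entries or satisfies
`‖x_{Cᶜ}‖₂ ≤ η ‖M_{Bᶜ} x‖_∞`. The norm on functions on a finite type is the sup norm (which is `0`
on the empty type). -/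
def ErasureRobust {N n : ℕ} (M : Matrix (Fin N) (Fin n) ℝ) (b b' η τ : ℝ) : Prop :=
  ∀ B : Finset (Fin N), (B.card : ℝ) ≤ b →
    ∃ C : Finset (Fin n), (C.card : ℝ) ≤ b' ∧
      ∀ x : Fin n → ℝ, τ ≤ (nnz x : ℝ) ∨
        Real.sqrt (∑ j ∈ Cᶜ, x j ^ 2) ≤ η * ‖fun i : {i : Fin N // i ∉ B} => (M *ᵥ x) i‖

/-- `lam` is the smallest nonzero eigenvalue of `A`. -/
def IsSmallestNonzeroEigenvalue {n : ℕ} (A : Matrix (Fin n) (Fin n) ℝ) (lam : ℝ) : Prop :=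
  IsLeast {μ : ℝ | μ ≠ 0 ∧ Module.End.HasEigenvalue (Matrix.toLin' A) μ} lam

/-- The covariance matrix `(MᵀM + ε I)⁻¹`. -/
def covMat {N n : ℕ} (M : Matrix (Fin N) (Fin n) ℝ) (ε : ℝ) : Matrix (Fin n) (Fin n) ℝ :=
  (Mᵀ * M + ε • (1 : Matrix (Fin n) (Fin n) ℝ))⁻¹

/-- The law of `m` independent samples from the centred Gaussian with covariance `Sig`. -/
def sampleLaw {n : ℕ} (Sig : Matrix (Fin n) (Fin n) ℝ) (m : ℕ) :
    Measure (Fin m → EuclideanSpace ℝ (Fin n)) :=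
  Measure.pi (fun _ => multivariateGaussian 0 Sig)

/-- The design matrix whose rows are the samples. -/
def designMatrix {n m : ℕ} (X : Fin m → EuclideanSpace ℝ (Fin n)) : Matrix (Fin m) (Fin n) ℝ :=
  Matrix.of (fun i j => X i j)

/-- The `S`-preconditioned Lasso fails on the samples `X` and the signal `w`: the signal is not a
minimizer of `‖Sᵀ w'‖₁` subject to `X w' = X w`, because some feasible vector has a strictly smaller
objective value. -/
def LassoFails {n m : ℕ} (S : Matrix (Fin n) (Fin n) ℝ) (w : Fin n → ℝ)
    (X : Fin m → EuclideanSpace ℝ (Fin n)) : Prop :=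
  ∃ w' : Fin n → ℝ, designMatrix X *ᵥ w' = designMatrix X *ᵥ w ∧
    l1Norm (Sᵀ *ᵥ w') < l1Norm (Sᵀ *ᵥ w)

/-- The uniform distribution on `[-1, 1]`. -/
def unifLaw : Measure ℝ := ProbabilityTheory.cond volume (Set.Icc (-1) 1)

/-- The signal `z₀ √ε w̃ + ∑ᵢ zᵢ M_{Rᵢ} / √(M_{Rᵢ}ᵀ Σ M_{Rᵢ})` with `Σ = covMat M ε`, where `w̃` agrees
with `v` on `K` and vanishes off `K`. A zero row of `M` contributes `0`. -/
def signal {N n t : ℕ} (M : Matrix (Fin N) (Fin n) ℝ) (ε : ℝ) (R : Fin t → Fin N)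
    (K : Finset (Fin n)) (z₀ : ℝ) (z : Fin t → ℝ) (v : Fin n → ℝ) : Fin n → ℝ :=
  (z₀ * Real.sqrt ε) • (fun j => if j ∈ K then v j else 0) +
    ∑ i, (z i / Real.sqrt (M (R i) ⬝ᵥ (covMat M ε *ᵥ M (R i)))) • M (R i)

/-- The law of `signal M ε R K z₀ z v` when the `t` row indices `R`, the set `K` of `k` coordinates,
the coefficients `z₀, z` and the entries `v` are independent, with `R` and `K` uniform and all reals
uniform on `[-1, 1]`: the average over `R` and `K` of the laws conditional on `R` and `K`. -/
def signalLaw {N n : ℕ} (M : Matrix (Fin N) (Fin n) ℝ) (ε : ℝ) (k t : ℕ) :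
    Measure (Fin n → ℝ) :=
  ((N ^ t * n.choose k : ℕ) : ℝ≥0∞)⁻¹ •
    ∑ R : Fin t → Fin N, ∑ K ∈ Finset.powersetCard k (Finset.univ : Finset (Fin n)),
      Measure.map (fun p : ℝ × (Fin t → ℝ) × (Fin n → ℝ) => signal M ε R K p.1 p.2.1 p.2.2)
        (unifLaw.prod ((Measure.pi (fun _ : Fin t => unifLaw)).prod
          (Measure.pi (fun _ : Fin n => unifLaw))))

end PrecondLasso

end

/-!
The constant is `c = 1`. Write `Σ = covMat M ε`, `‖x‖_Σ = √(xᵀ Σ x)`, let `s_i` be the columns of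
`S`, and let `N = n - r` be the number of rows of `M`.

*Failure by infinitesimal descent* (`lassoFails_of_descent`). The objective `‖Sᵀ w‖₁` is linear
near a signal `w` except for the columns orthogonal to `w`. Moving from `w` towards a vector `u`
with `X u = X w` that is orthogonal to the gradient `∑ sign ⟪s_i, w⟫ s_i` changes the objective at
the rate `∑ |⟪s_i, u⟫| - ‖Sᵀ w‖₁`, where the sum is over the columns with `⟪s_i, w⟫ = 0`. So the
Lasso fails as soon as those columns are small on `u`.

*Short solutions* (`pi_stdGaussian_exists_mem_norm_le`). On the kernel of `M` the samples have
variance `1 / ε`. In a subspace of the kernel of dimension `3m`, with the gradient direction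
removed, the `m` equations `X u = X w` therefore have a solution with `‖u‖ ≤ 4 √ε ‖w‖_Σ`, outside
an event of probability `exp (-m)`. This amounts to saying that a fixed unit vector keeps a
constant fraction of its length when projected to the kernel of `m` Gaussian functionals in
dimension at least `3m`. By rotation invariance, the unit vector may be replaced by an independent
Gaussian direction; with the functionals fixed, Chernoff's bound for sums of Gaussian squares
applies (`pi_gaussianReal_sum_sq_le`).

*The signal* (`one_sub_le_coeffLaw_lassoFails`). Let `B` consist of the `⌊b⌋` rows (or all of them)
with the largest values of `‖Sᵀ M_j‖₁ / ‖M_j‖_Σ`. With probability `1 - exp (-t b / N)` some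
`M_{R_i}` has a value at least as large as all rows outside `B`; let `Q` be that value. The
coefficient of this row is uniform on an interval, so `‖Sᵀ w‖₁ ≥ n⁻⁵¹ Q` except with probability
`n⁻⁵¹`. A column with at least `τ` nonzero entries meets the random set `K` up to probability
`n ^ (-(l + 1))`, and then it is almost surely not orthogonal to `w`. All other columns satisfy the
conclusion of erasure-robustness for `B`. For `u` in the kernel of `M` vanishing on `C`, the sum
above is then at most `η ‖u‖ Q ∑ ‖M_j‖_Σ` (`sum_abs_transpose_mulVec_le`). Since every nonzero
eigenvalue of `MᵀM` is at least `λ`, the Cauchy–Schwarz inequality gives `∑ ‖M_j‖_Σ ≤ √n ‖M‖_F /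
√λ` (`sum_covNorm_row_le`). With `‖w‖_Σ ≤ 2n`, the sum is at most `8 n^(3/2) η ‖M‖_F √(ε/λ) Q`,
which by hypothesis is less than `n⁻⁵¹ Q` unless `Q = 0`; and `‖Sᵀ w‖₁ > 0` almost surely.

The error terms fit into `n ^ (-l)`: if all `n` columns are dense, anticoncentration is not needed,
and otherwise the union bound is over at most `n - 1` columns (`card_mul_rpow_add_le`).

If `k > n` or `t > n`, then `k (t + 1) ≥ n` and the sparsity bound is void. A uniform random signal
is then almost surely orthogonal to no column of `S` (`ae_pi_unifLaw_lassoFails`).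
-/

namespace PrecondLasso

open scoped RealInnerProductSpace

/-! ### A Chernoff bound for Gaussian squares -/

theorem integral_exp_mul_sq_gaussianReal {c : ℝ} (hc : c < 1 / 2) :
    ∫ x, Real.exp (c * x ^ 2) ∂(gaussianReal 0 1) = (Real.sqrt (1 - 2 * c))⁻¹ := by
  rw [integral_gaussianReal_eq_integral_smul one_ne_zero]
  have h : ∀ x : ℝ, gaussianPDFReal 0 1 x • Real.exp (c * x ^ 2)
      = (Real.sqrt (2 * Real.pi))⁻¹ * Real.exp (-(1 / 2 - c) * x ^ 2) := by
    intro x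
    simp only [gaussianPDFReal_def, smul_eq_mul, NNReal.coe_one, mul_one, sub_zero]
    rw [mul_assoc, ← Real.exp_add]
    congr 2
    ring
  simp_rw [h]
  rw [integral_const_mul, integral_gaussian, ← Real.sqrt_inv, ← Real.sqrt_mul (by positivity),
    ← Real.sqrt_inv]
  congr 1
  have h1 : (1 - 2 * c) ≠ 0 := by linarith
  have h2 : (1 / 2 - c) ≠ 0 := by intro h; apply h1; linarith
  field_simp

theorem integrable_exp_mul_sq_gaussianReal {c : ℝ} (hc : c < 1 / 2) :
    Integrable (fun x => Real.exp (c * x ^ 2)) (gaussianReal 0 1) := by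
  refine Integrable.of_integral_ne_zero ?_
  rw [integral_exp_mul_sq_gaussianReal hc]
  have : 0 < 1 - 2 * c := by linarith
  positivity

/-- Chernoff's bound with the exponential moments at `1/4` and `-2`: a sum of at most `m` squares
of independent standard Gaussians is unlikely to reach `8` times a sum of at least `2m` further
ones. -/
theorem pi_gaussianReal_sum_sq_le {ι : Type*} [Fintype ι] [DecidableEq ι] (s : Finset ι) (m : ℕ)
    (hs : 2 * m ≤ s.card) (hsc : sᶜ.card ≤ m) :
    (Measure.pi (fun _ : ι => gaussianReal 0 1)).real
      {x | 8 * ∑ i ∈ s, x i ^ 2 ≤ ∑ i ∈ sᶜ, x i ^ 2} ≤ Real.exp (-m) := by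
  set μ := Measure.pi (fun _ : ι => gaussianReal 0 1)
  let c : ι → ℝ := fun i => if i ∈ s then -2 else 1 / 4
  have hc : ∀ i, c i < 1 / 2 := by intro i; simp only [c]; split_ifs <;> norm_num
  have hint : Integrable (fun x : ι → ℝ => ∏ i, Real.exp (c i * x i ^ 2)) μ :=
    Integrable.fintype_prod_dep (f := fun i (y : ℝ) => Real.exp (c i * y ^ 2))
      fun i => integrable_exp_mul_sq_gaussianReal (hc i)
  have hval : ∫ x, ∏ i, Real.exp (c i * x i ^ 2) ∂μ
      = (Real.sqrt 5)⁻¹ ^ s.card * Real.sqrt 2 ^ sᶜ.card := by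
    rw [integral_fintype_prod_eq_prod (f := fun i (y : ℝ) => Real.exp (c i * y ^ 2))]
    simp_rw [integral_exp_mul_sq_gaussianReal (hc _)]
    rw [← Finset.prod_mul_prod_compl s]
    congr 1
    · rw [Finset.prod_congr rfl (g := fun _ => (Real.sqrt 5)⁻¹), Finset.prod_const]
      intro i hi
      simp only [c, hi, if_true]
      norm_num
    · rw [Finset.prod_congr rfl (g := fun _ => Real.sqrt 2), Finset.prod_const]
      intro i hi
      simp only [c, Finset.mem_compl.mp hi, if_false]
      rw [← Real.sqrt_inv]
      norm_num
  have hmarkov := mul_meas_ge_le_integral_of_nonneg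
    (Filter.Eventually.of_forall fun x => Finset.prod_nonneg fun i _ => (Real.exp_pos _).le) hint 1
  rw [hval, one_mul] at hmarkov
  refine (measureReal_mono ?_).trans (hmarkov.trans ?_)
  · intro x hx
    simp only [Set.mem_ofPred_eq] at hx ⊢
    rw [← Real.exp_sum]
    refine Real.one_le_exp ?_
    rw [← Finset.sum_add_sum_compl s]
    have h1 : ∑ i ∈ s, c i * x i ^ 2 = -2 * ∑ i ∈ s, x i ^ 2 := by
      rw [Finset.mul_sum]
      refine Finset.sum_congr rfl fun i hi => ?_
      simp only [c, hi, if_true]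
    have h2 : ∑ i ∈ sᶜ, c i * x i ^ 2 = 1 / 4 * ∑ i ∈ sᶜ, x i ^ 2 := by
      rw [Finset.mul_sum]
      refine Finset.sum_congr rfl fun i hi => ?_
      simp only [c, Finset.mem_compl.mp hi, if_false]
    rw [h1, h2]
    linarith
  · have h5 : (Real.sqrt 5)⁻¹ ≤ 1 :=
      inv_le_one_of_one_le₀ (Real.one_le_sqrt.mpr (by norm_num))
    have h2 : 1 ≤ Real.sqrt 2 := Real.one_le_sqrt.mpr (by norm_num)
    calc (Real.sqrt 5)⁻¹ ^ s.card * Real.sqrt 2 ^ sᶜ.card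
        ≤ (Real.sqrt 5)⁻¹ ^ (2 * m) * Real.sqrt 2 ^ m := by
          gcongr ?_ * ?_
          · exact pow_le_pow_of_le_one (by positivity) h5 hs
          · exact pow_le_pow_right₀ h2 hsc
      _ = (Real.sqrt 2 / 5) ^ m := by
          rw [pow_mul, ← mul_pow, inv_pow, Real.sq_sqrt (by norm_num), div_eq_inv_mul]
      _ ≤ Real.exp (-1) ^ m := by
          gcongr
          rw [Real.exp_neg, div_le_iff₀ (by norm_num), ← div_eq_inv_mul,
            le_div_iff₀ (Real.exp_pos 1)]
          have he := Real.exp_one_lt_d9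
          have hs2 : Real.sqrt 2 ≤ 3 / 2 := by
            rw [Real.sqrt_le_left (by norm_num)]; norm_num
          nlinarith [Real.exp_pos 1, Real.sqrt_nonneg 2]
      _ = Real.exp (-m) := by
          rw [← Real.exp_nat_mul]
          congr 1
          ring

/-! ### Gaussian linear equations within a subspace -/

section Gaussian

variable {V : Type*} [NormedAddCommGroup V] [InnerProductSpace ℝ V] [FiniteDimensional ℝ V]

/-- The pairs `(ξ, G)` for which the common kernel of the functionals `⟪G i, ·⟫` contains a vector
of norm at most `3` whose component in the direction of `ξ` is `1`. For `ξ = 0` the condition on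
the component reads `0 = 0`. -/
def kernelAligned (V : Type*) [NormedAddCommGroup V] [InnerProductSpace ℝ V] (m : ℕ) :
    Set (V × (Fin m → V)) :=
  {p | ∃ z : V, (∀ i, ⟪p.2 i, z⟫ = 0) ∧ ⟪z, p.1⟫ = ‖p.1‖ ∧ ‖z‖ ≤ 3}

/-- The set is the projection of a closed set along a compact ball. -/
theorem isClosed_kernelAligned (m : ℕ) : IsClosed (kernelAligned V m) := by
  have hcl : IsClosed {q : (V × (Fin m → V)) × Metric.closedBall (0 : V) 3 |
      (∀ i, ⟪q.1.2 i, (q.2 : V)⟫ = 0) ∧ ⟪(q.2 : V), q.1.1⟫ = ‖q.1.1‖} := by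
    rw [Set.ofPred_and, Set.ofPred_forall]
    refine IsClosed.inter (isClosed_iInter fun i => isClosed_eq ?_ ?_) (isClosed_eq ?_ ?_) <;>
      fun_prop
  have : ProperSpace V := FiniteDimensional.proper ℝ V
  have : CompactSpace (Metric.closedBall (0 : V) 3) :=
    isCompact_iff_compactSpace.mp (isCompact_closedBall 0 3)
  have := isClosedMap_fst_of_compactSpace _ hcl
  convert this using 1
  ext p
  constructor
  · rintro ⟨z, h1, h2, h3⟩
    exact ⟨(p, ⟨z, by simpa using h3⟩), ⟨h1, h2⟩, rfl⟩
  · rintro ⟨⟨p', z⟩, ⟨h1, h2⟩, rfl⟩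
    exact ⟨z, h1, h2, mem_closedBall_zero_iff.mp z.2⟩

variable [MeasurableSpace V] [BorelSpace V]

/-- For fixed vectors `G 1, …, G m` in a space of dimension at least `3m`, a Gaussian direction is
aligned with the common kernel. -/
theorem stdGaussian_not_kernelAligned_le {m : ℕ} (hd : 3 * m ≤ Module.finrank ℝ V)
    (G : Fin m → V) :
    (stdGaussian V).real {ξ | (ξ, G) ∉ kernelAligned V m ∨ ξ = 0} ≤ Real.exp (-m) := by
  classical
  set R : Submodule ℝ V := Submodule.span ℝ (Set.range G)
  have hR : Module.finrank ℝ R ≤ m := by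
    have h := finrank_range_le_card (R := ℝ) G
    rwa [Fintype.card_fin] at h
  have hdim := R.finrank_add_finrank_orthogonal
  set d := Module.finrank ℝ V
  set p := Module.finrank ℝ Rᗮ
  -- an orthonormal basis of `V` whose first `p` vectors span the common kernel
  let f : Fin d → V := fun i => if h : (i : ℕ) < p then (stdOrthonormalBasis ℝ Rᗮ ⟨i, h⟩ : V) else 0
  let s : Finset (Fin d) := Finset.univ.filter fun i => (i : ℕ) < p
  have hf : Orthonormal ℝ ((s : Set (Fin d)).domRestrict f) := by
    rw [orthonormal_iff_ite]
    rintro ⟨i, hi⟩ ⟨j, hj⟩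
    simp only [s, Finset.coe_filter, Finset.mem_univ, true_and, Set.mem_ofPred_eq] at hi hj
    have := orthonormal_iff_ite.mp (stdOrthonormalBasis ℝ Rᗮ).orthonormal ⟨i, hi⟩ ⟨j, hj⟩
    simp only [f, Set.domRestrict_apply, dif_pos hi, dif_pos hj, Subtype.mk.injEq]
    rw [← Submodule.coe_inner, this]
    simp [Fin.ext_iff]
  obtain ⟨b, hb⟩ := hf.exists_orthonormalBasis_extension_of_card_eq (by simp [d])
  have hbs : ∀ i ∈ s, b i ∈ Rᗮ := by
    intro i hi
    rw [hb i hi]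
    have : (i : ℕ) < p := by simpa [s] using hi
    simp only [f, dif_pos this]
    exact Submodule.coe_mem _
  have hscard : s.card = p := by
    have : s.card = min d p := by
      simp only [s]
      rw [Fin.card_filter_val_lt]
    rw [this]
    omega
  have hsc : sᶜ.card ≤ m := by
    rw [Finset.card_compl, Fintype.card_fin]
    omega
  rw [stdGaussian_eq_map_pi_orthonormalBasis b]
  have hbmeas : Measurable fun x : Fin d → ℝ => ∑ i, x i • b i := by fun_prop
  rw [map_measureReal_apply hbmeas]
  swap
  · refine MeasurableSet.union ?_ (MeasurableSet.singleton 0)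
    exact ((isClosed_kernelAligned m).measurableSet.preimage (by fun_prop)).compl
  refine (measureReal_mono ?_).trans (pi_gaussianReal_sum_sq_le s m (by omega) hsc)
  intro x hx
  simp only [Set.mem_ofPred_eq]
  by_contra! hlt
  set ξ := ∑ i, x i • b i with hξ
  set z := ∑ i, (if i ∈ s then x i else 0) • b i with hz
  set A := ∑ i ∈ s, x i ^ 2 with hA
  have hzξ : ⟪z, ξ⟫ = A := by
    rw [hz, hξ, b.orthonormal.inner_sum]
    simp [hA, sq, Finset.sum_ite_mem]
  have hzz : ‖z‖ ^ 2 = A := by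
    rw [← real_inner_self_eq_norm_sq, hz, b.orthonormal.inner_sum]
    simp [hA, sq, Finset.sum_ite_mem]
  have hξξ : ‖ξ‖ ^ 2 ≤ 9 * A := by
    rw [← real_inner_self_eq_norm_sq, hξ, b.orthonormal.inner_sum,
      ← Finset.sum_add_sum_compl s]
    simp only [conj_trivial, ← sq]
    linarith
  have hA0 : 0 < A := by
    have h1 : 0 ≤ ∑ i ∈ sᶜ, x i ^ 2 := Finset.sum_nonneg fun i _ => sq_nonneg _
    linarith
  rcases hx with hx | hx
  · refine hx ⟨(‖ξ‖ / A) • z, fun i => ?_, ?_, ?_⟩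
    · have hzR : z ∈ Rᗮ := by
        refine Submodule.sum_mem _ fun i _ => ?_
        split_ifs with hi
        · exact Submodule.smul_mem _ _ (hbs i hi)
        · simp
      rw [inner_smul_right, (Submodule.mem_orthogonal R z).mp hzR _
        (Submodule.subset_span ⟨i, rfl⟩), mul_zero]
    · rw [real_inner_smul_left, hzξ, div_mul_cancel₀ _ hA0.ne']
    · rw [norm_smul, Real.norm_of_nonneg (by positivity), div_mul_eq_mul_div, div_le_iff₀ hA0]
      refine abs_le_of_sq_le_sq' ?_ (by positivity) |>.2
      rw [mul_pow, mul_pow, hzz]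
      nlinarith
  · change ξ = 0 at hx
    rw [hx, inner_zero_right] at hzξ
    exact hA0.ne hzξ

/-- The orthogonal projection of a standard Gaussian is standard Gaussian. -/
theorem stdGaussian_map_orthogonalProjection (W : Submodule ℝ V) :
    (stdGaussian V).map W.orthogonalProjectionOnto = stdGaussian W := by
  apply Measure.ext_of_charFun
  ext t
  rw [charFun_stdGaussian, charFun_apply, integral_map (by fun_prop) (by fun_prop)]
  have := charFun_stdGaussian (t : V)
  rw [charFun_apply] at this
  simp_rw [Submodule.inner_orthogonalProjectionOnto_eq_of_mem_right]
  simpa using this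

/-- The span of `m` standard Gaussian vectors in dimension at least `3m` leaves a constant fraction
of any fixed unit vector uncovered. By rotation invariance the fixed vector may be replaced by an
independent Gaussian direction, to which Chernoff's bound applies after conditioning on the span. -/
theorem pi_stdGaussian_kernelAligned {m : ℕ} (hd : 3 * m ≤ Module.finrank ℝ V) {e : V}
    (he : ‖e‖ = 1) :
    (Measure.pi fun _ : Fin m => stdGaussian V) {G | (e, G) ∉ kernelAligned V m}
      ≤ ENNReal.ofReal (Real.exp (-m)) := by
  set μ := Measure.pi fun _ : Fin m => stdGaussian V
  have hbad : MeasurableSet {p : V × (Fin m → V) | p ∉ kernelAligned V m ∨ p.1 = 0} :=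
    (isClosed_kernelAligned m).measurableSet.compl.union
      (measurableSet_eq_fun measurable_fst measurable_const)
  have hrot : ∀ ξ : V, μ {G | (e, G) ∉ kernelAligned V m}
      ≤ μ {G | (ξ, G) ∉ kernelAligned V m ∨ ξ = 0} := by
    intro ξ
    rcases eq_or_ne ξ 0 with rfl | hξ
    · exact measure_mono fun G _ => Or.inr rfl
    have hξ' : 0 < ‖ξ‖ := norm_pos_iff.mpr hξ
    let L : V ≃ₗᵢ[ℝ] V := (ℝ ∙ (e - ‖ξ‖⁻¹ • ξ))ᗮ.reflection
    have hL : ‖ξ‖ • L e = ξ := by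
      have : L e = ‖ξ‖⁻¹ • ξ := Submodule.reflection_sub (by
        rw [he, norm_smul, norm_inv, norm_norm, inv_mul_cancel₀ hξ'.ne'])
      rw [this, smul_inv_smul₀ hξ'.ne']
    have hmap : μ.map (fun G i => L (G i)) = μ := by
      simp only [μ]
      rw [Measure.pi_map_pi (hμ := fun _ => by rw [stdGaussian_map]; infer_instance)
        (fun i => by fun_prop)]
      simp_rw [stdGaussian_map]
    have hmeas : MeasurableSet {G : Fin m → V | (ξ, G) ∉ kernelAligned V m ∨ ξ = 0} :=
      hbad.preimage measurable_prodMk_left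
    conv_rhs => rw [← hmap]
    rw [Measure.map_apply (by fun_prop) hmeas]
    refine measure_mono fun G hG => Or.inl ?_
    rintro ⟨z, h1, h2, h3⟩
    refine hG ⟨L.symm z, fun i => ?_, ?_, by simpa using h3⟩
    · rw [← h1 i]
      simpa using (L.inner_map_map (G i) (L.symm z)).symm
    · have h4 : ⟪L (L.symm z), L e⟫ = ⟪L.symm z, e⟫ := L.inner_map_map _ _
      rw [L.apply_symm_apply] at h4
      rw [← h4, he]
      simp only at h2
      conv_lhs at h2 => rw [← hL]
      rw [inner_smul_right] at h2
      field_simp at h2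
      exact h2
  calc μ {G | (e, G) ∉ kernelAligned V m}
      = ∫⁻ _ : V, μ {G | (e, G) ∉ kernelAligned V m} ∂(stdGaussian V) := by simp
    _ ≤ ∫⁻ ξ : V, μ {G | (ξ, G) ∉ kernelAligned V m ∨ ξ = 0} ∂(stdGaussian V) :=
        lintegral_mono hrot
    _ = ((stdGaussian V).prod μ) {p | p ∉ kernelAligned V m ∨ p.1 = 0} := by
        rw [Measure.prod_apply hbad]; rfl
    _ = ∫⁻ G, stdGaussian V {ξ | (ξ, G) ∉ kernelAligned V m ∨ ξ = 0} ∂μ := by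
        rw [Measure.prod_apply_symm hbad]; rfl
    _ ≤ ∫⁻ _, ENNReal.ofReal (Real.exp (-m)) ∂μ := by
        refine lintegral_mono fun G => ?_
        rw [ENNReal.le_ofReal_iff_toReal_le (measure_ne_top _ _) (Real.exp_pos _).le]
        exact stdGaussian_not_kernelAligned_le hd G
    _ = ENNReal.ofReal (Real.exp (-m)) := by simp

/-- Within a subspace `U` of dimension at least `3m - 1`, the `m` Gaussian equations
`⟪g i, u⟫ = ⟪g i, v⟫` have a solution not much longer than `v`. In the span of `U` and `v`, such a `u` is `v - z`
for a vector `z` of the common kernel that has the same component orthogonal to `U` as `v`. -/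
theorem pi_stdGaussian_exists_mem_norm_le {m : ℕ} (U : Submodule ℝ V)
    (hU : 3 * m ≤ Module.finrank ℝ U + 1) (v : V) :
    (Measure.pi fun _ : Fin m => stdGaussian V)
      {g | ¬ ∃ u ∈ U, (∀ i, ⟪g i, v - u⟫ = 0) ∧ ‖u‖ ≤ 4 * ‖v‖}
        ≤ ENNReal.ofReal (Real.exp (-m)) := by
  by_cases hv : v ∈ U
  · convert zero_le (a := ENNReal.ofReal (Real.exp (-m)))
    convert measure_empty (μ := Measure.pi fun _ : Fin m => stdGaussian V)
    ext g
    simp only [Set.mem_ofPred_eq, Set.mem_empty_iff_false, iff_false, not_not]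
    exact ⟨v, hv, fun i => by simp, by linarith [norm_nonneg v]⟩
  set W : Submodule ℝ V := U ⊔ ℝ ∙ v
  have hvW : v ∈ W := Submodule.mem_sup_right (Submodule.mem_span_singleton_self v)
  have hUW : U ≤ W := le_sup_left
  set q : V := v - U.starProjection v with hq
  have hqU : ∀ u ∈ U, ⟪u, q⟫ = 0 := fun u hu =>
    (Submodule.mem_orthogonal U q).mp (Submodule.sub_starProjection_mem_orthogonal v) u hu
  have hPU : U.starProjection v ∈ U := U.starProjection_apply_mem v
  have hqW : q ∈ W := Submodule.sub_mem _ hvW (hUW hPU)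
  have hq0 : q ≠ 0 := fun h => hv (by rwa [sub_eq_zero.mp h])
  have hqpos : 0 < ‖q‖ := norm_pos_iff.mpr hq0
  have hvq : ⟪v, q⟫ = ‖q‖ ^ 2 := by
    rw [← real_inner_self_eq_norm_sq]
    conv_rhs => rw [hq, inner_sub_left, ← hq, hqU _ hPU, sub_zero]
  have hqv : ‖q‖ ≤ ‖v‖ := by
    have := real_inner_le_norm v q
    rw [hvq, sq] at this
    exact le_of_mul_le_mul_right this hqpos
  let e : W := ‖q‖⁻¹ • ⟨q, hqW⟩
  have he : ‖e‖ = 1 := by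
    simp only [e, norm_smul, norm_inv, norm_norm, Submodule.coe_norm]
    exact inv_mul_cancel₀ hqpos.ne'
  have hdim : 3 * m ≤ Module.finrank ℝ W := by
    have : U < W := lt_of_le_of_ne hUW fun h => hv (h ▸ hvW)
    have := Submodule.finrank_lt_finrank_of_lt this
    omega
  have hmap : (Measure.pi fun _ : Fin m => stdGaussian V).map
      (fun g i => W.orthogonalProjectionOnto (g i))
        = Measure.pi fun _ : Fin m => stdGaussian W := by
    rw [Measure.pi_map_pi
      (hμ := fun _ => by rw [stdGaussian_map_orthogonalProjection]; infer_instance)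
      (fun i => by fun_prop)]
    simp_rw [stdGaussian_map_orthogonalProjection]
  refine le_trans ?_ (pi_stdGaussian_kernelAligned hdim he)
  rw [← hmap, Measure.map_apply (by fun_prop)]
  swap
  · exact ((isClosed_kernelAligned m).measurableSet.preimage measurable_prodMk_left).compl
  refine measure_mono fun g hg => ?_
  rintro ⟨z, h1, h2, h3⟩
  refine hg ⟨v - ‖q‖ • (z : V), ?_, fun i => ?_, ?_⟩
  · have hzq : ⟪(z : V), q⟫ = ‖q‖ := by
      simp only [he, e, inner_smul_right, Submodule.coe_inner] at h2
      field_simp at h2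
      exact h2
    obtain ⟨a, ha, b, hb, hab⟩ := Submodule.mem_sup.mp
      (Submodule.sub_mem W hvW (Submodule.smul_mem W ‖q‖ z.2))
    obtain ⟨t, rfl⟩ := Submodule.mem_span_singleton.mp hb
    have h4 : ⟪v - ‖q‖ • (z : V), q⟫ = 0 := by
      rw [inner_sub_left, real_inner_smul_left, hzq, hvq, sq, sub_self]
    rw [← hab, inner_add_left, hqU a ha, real_inner_smul_left, hvq, zero_add] at h4
    have ht : t = 0 := by
      rcases mul_eq_zero.mp h4 with h | h
      · exact h
      · exact absurd h (by positivity)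
    rw [← hab, ht, zero_smul, add_zero]
    exact ha
  · have := h1 i
    simp only at this
    rw [sub_sub_cancel, inner_smul_right,
      ← Submodule.inner_orthogonalProjectionOnto_eq_of_mem_right z (g i), this, mul_zero]
  · calc ‖v - ‖q‖ • (z : V)‖ ≤ ‖v‖ + ‖q‖ * ‖(z : V)‖ := by
          refine (norm_sub_le _ _).trans ?_
          rw [norm_smul, norm_norm]
      _ ≤ ‖v‖ + ‖v‖ * 3 := by
          gcongr
          exact h3
      _ = 4 * ‖v‖ := by ring

end Gaussian

/-! ### The covariance matrix and its norm -/

theorem dotProduct_self_nonneg {n : ℕ} (x : Fin n → ℝ) : 0 ≤ x ⬝ᵥ x :=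
  Finset.sum_nonneg fun i _ => mul_self_nonneg (x i)

section Covariance

open scoped MatrixOrder

variable {N n : ℕ} (M : Matrix (Fin N) (Fin n) ℝ) {ε : ℝ}

theorem posDef_gram_add_smul_one (hε : 0 < ε) :
    (Mᵀ * M + ε • (1 : Matrix (Fin n) (Fin n) ℝ)).PosDef := by
  refine PosDef.posSemidef_add ?_ (PosDef.one.smul hε)
  simpa [conjTranspose_eq_transpose_of_trivial] using posSemidef_conjTranspose_mul_self M

theorem posDef_covMat (hε : 0 < ε) : (covMat M ε).PosDef :=
  (posDef_gram_add_smul_one M hε).inv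

theorem isSymm_covMat (hε : 0 < ε) : (covMat M ε)ᵀ = covMat M ε := by
  rw [← conjTranspose_eq_transpose_of_trivial]
  exact (posDef_covMat M hε).isHermitian

theorem gram_mulVec_covMat_mulVec (hε : 0 < ε) (x : Fin n → ℝ) :
    Mᵀ *ᵥ (M *ᵥ (covMat M ε *ᵥ x)) + ε • (covMat M ε *ᵥ x) = x := by
  have h : (Mᵀ * M + ε • (1 : Matrix (Fin n) (Fin n) ℝ)) *ᵥ (covMat M ε *ᵥ x) = x := by
    rw [mulVec_mulVec, covMat, mul_nonsing_inv _
      ((isUnit_iff_isUnit_det _).mp (posDef_gram_add_smul_one M hε).isUnit), one_mulVec]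
  rwa [add_mulVec, smul_mulVec, one_mulVec, ← mulVec_mulVec] at h

theorem covMat_mulVec_of_gram_mulVec (hε : 0 < ε) {x : Fin n → ℝ} {μ : ℝ} (hμ : μ + ε ≠ 0)
    (hx : (Mᵀ * M) *ᵥ x = μ • x) : covMat M ε *ᵥ x = (μ + ε)⁻¹ • x := by
  have h : (Mᵀ * M + ε • (1 : Matrix (Fin n) (Fin n) ℝ)) *ᵥ x = (μ + ε) • x := by
    rw [add_mulVec, smul_mulVec, one_mulVec, hx, add_smul]
  have h2 : covMat M ε *ᵥ ((μ + ε) • x) = x := by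
    rw [← h, mulVec_mulVec, covMat, nonsing_inv_mul _
      ((isUnit_iff_isUnit_det _).mp (posDef_gram_add_smul_one M hε).isUnit), one_mulVec]
  rw [mulVec_smul] at h2
  rw [eq_inv_smul_iff₀ hμ, h2]

/-- The seminorm `√(xᵀ Σ x)` with `Σ = covMat M ε`: the standard deviation of `⟪X, x⟫` for a sample
`X`. -/
noncomputable def covNorm (M : Matrix (Fin N) (Fin n) ℝ) (ε : ℝ) (x : Fin n → ℝ) : ℝ :=
  Real.sqrt (x ⬝ᵥ (covMat M ε *ᵥ x))

/-- The symmetric square root of `covMat M ε`, as an operator. -/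
noncomputable def sqrtCov (M : Matrix (Fin N) (Fin n) ℝ) (ε : ℝ) :
    EuclideanSpace ℝ (Fin n) →L[ℝ] EuclideanSpace ℝ (Fin n) :=
  toEuclideanCLM (𝕜 := ℝ) (CFC.sqrt (covMat M ε))

theorem inner_sqrtCov_left (x y : EuclideanSpace ℝ (Fin n)) :
    ⟪sqrtCov M ε x, y⟫ = ⟪x, sqrtCov M ε y⟫ := by
  have h : IsSelfAdjoint (sqrtCov M ε) :=
    (CFC.sqrt_nonneg (covMat M ε)).isSelfAdjoint.map
      (toEuclideanCLM (n := Fin n) (𝕜 := ℝ))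
  rw [← ContinuousLinearMap.adjoint_inner_right, h.adjoint_eq]

theorem sqrtCov_sqrtCov (hε : 0 < ε) (x : Fin n → ℝ) :
    sqrtCov M ε (sqrtCov M ε (WithLp.toLp 2 x)) = WithLp.toLp 2 (covMat M ε *ᵥ x) := by
  rw [sqrtCov, toEuclideanCLM_toLp, toEuclideanCLM_toLp, mulVec_mulVec]
  rw [CFC.sqrt_mul_sqrt_self _ (posDef_covMat M hε).posSemidef.nonneg]

theorem norm_sqrtCov (hε : 0 < ε) (x : Fin n → ℝ) :
    ‖sqrtCov M ε (WithLp.toLp 2 x)‖ = covNorm M ε x := by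
  rw [covNorm, norm_eq_sqrt_real_inner, inner_sqrtCov_left, sqrtCov_sqrtCov M hε]
  congr 1
  rw [EuclideanSpace.inner_toLp_toLp, star_trivial, dotProduct_comm]

theorem covNorm_nonneg (x : Fin n → ℝ) : 0 ≤ covNorm M ε x := Real.sqrt_nonneg _

theorem covNorm_sq (hε : 0 < ε) (x : Fin n → ℝ) :
    covNorm M ε x ^ 2 = x ⬝ᵥ (covMat M ε *ᵥ x) := by
  refine Real.sq_sqrt ?_
  simpa using (posDef_covMat M hε).posSemidef.dotProduct_mulVec_nonneg x

theorem covNorm_add_le (hε : 0 < ε) (x y : Fin n → ℝ) :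
    covNorm M ε (x + y) ≤ covNorm M ε x + covNorm M ε y := by
  simp_rw [← norm_sqrtCov M hε, WithLp.toLp_add, map_add]
  exact norm_add_le _ _

theorem covNorm_smul (hε : 0 < ε) (c : ℝ) (x : Fin n → ℝ) :
    covNorm M ε (c • x) = |c| * covNorm M ε x := by
  simp_rw [← norm_sqrtCov M hε, WithLp.toLp_smul, map_smul, norm_smul, Real.norm_eq_abs]

theorem covNorm_sum_le (hε : 0 < ε) {ι : Type*} (s : Finset ι) (f : ι → Fin n → ℝ) :
    covNorm M ε (∑ i ∈ s, f i) ≤ ∑ i ∈ s, covNorm M ε (f i) := by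
  simp_rw [← norm_sqrtCov M hε, WithLp.toLp_sum, map_sum]
  exact norm_sum_le _ _

theorem eq_zero_of_covNorm_eq_zero (hε : 0 < ε) {x : Fin n → ℝ} (h : covNorm M ε x = 0) :
    x = 0 := by
  by_contra hx
  have h1 := (posDef_covMat M hε).dotProduct_mulVec_pos hx
  rw [star_trivial, ← covNorm_sq M hε, h] at h1
  norm_num at h1

theorem sqrtCov_injective (hε : 0 < ε) : Function.Injective (sqrtCov M ε) := by
  rw [injective_iff_map_eq_zero]
  intro x hx
  have h : covNorm M ε x.ofLp = 0 := by
    rw [← norm_sqrtCov M hε, WithLp.toLp_ofLp, hx, norm_zero]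
  have := eq_zero_of_covNorm_eq_zero M hε h
  ext i
  rw [this]
  rfl

theorem covNorm_of_mulVec_eq_zero (hε : 0 < ε) {u : Fin n → ℝ} (hu : M *ᵥ u = 0) :
    covNorm M ε u = Real.sqrt (u ⬝ᵥ u) / Real.sqrt ε := by
  rw [covNorm, covMat_mulVec_of_gram_mulVec M hε (μ := 0) (by simpa using hε.ne')
    (by rw [← mulVec_mulVec, hu]; simp), dotProduct_smul, zero_add, smul_eq_mul, inv_mul_eq_div,
    Real.sqrt_div' _ hε.le]

theorem covNorm_le (hε : 0 < ε) (x : Fin n → ℝ) :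
    covNorm M ε x ≤ Real.sqrt (x ⬝ᵥ x) / Real.sqrt ε := by
  rw [covNorm, ← Real.sqrt_div' _ hε.le]
  refine Real.sqrt_le_sqrt ?_
  rw [le_div_iff₀ hε]
  set y := covMat M ε *ᵥ x
  have hxy : Mᵀ *ᵥ (M *ᵥ y) + ε • y = x := gram_mulVec_covMat_mulVec M hε x
  have h1 : Mᵀ *ᵥ (M *ᵥ y) ⬝ᵥ y = (M *ᵥ y) ⬝ᵥ (M *ᵥ y) := by
    rw [mulVec_transpose, ← dotProduct_mulVec]
  have h2 : 0 ≤ (M *ᵥ y) ⬝ᵥ (M *ᵥ y) := dotProduct_self_nonneg _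
  have h3 : 0 ≤ (Mᵀ *ᵥ (M *ᵥ y)) ⬝ᵥ (Mᵀ *ᵥ (M *ᵥ y)) := dotProduct_self_nonneg _
  conv_lhs => rw [← hxy]
  conv_rhs => rw [← hxy]
  simp only [add_dotProduct, dotProduct_add, smul_dotProduct, dotProduct_smul, smul_eq_mul]
  rw [dotProduct_comm y (Mᵀ *ᵥ (M *ᵥ y)), h1]
  nlinarith [mul_nonneg hε.le h2]

/-- Every eigenvector of `MᵀM` is either in the kernel of `M`, hence orthogonal to the rows, or has
eigenvalue at least `lam`. -/
theorem sqrt_mul_covNorm_row_le (hε : 0 < ε) {lam : ℝ}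
    (hlam : IsSmallestNonzeroEigenvalue (Mᵀ * M) lam) (hpos : 0 < lam) (j : Fin N) :
    Real.sqrt lam * covNorm M ε (M j) ≤ Real.sqrt (M j ⬝ᵥ M j) := by
  rw [covNorm, ← Real.sqrt_mul hpos.le]
  refine Real.sqrt_le_sqrt ?_
  have hps : (Mᵀ * M).PosSemidef := by
    simpa [conjTranspose_eq_transpose_of_trivial] using posSemidef_conjTranspose_mul_self M
  have hH := hps.isHermitian
  set b := hH.eigenvectorBasis
  set μ := hH.eigenvalues
  have hb : ∀ i, (Mᵀ * M) *ᵥ (b i).ofLp = μ i • (b i).ofLp := fun i => hH.mulVec_eigenvectorBasis i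
  have hμ : ∀ i, 0 ≤ μ i := hps.eigenvalues_nonneg
  have hin : ∀ (i) (x : Fin n → ℝ), ⟪b i, WithLp.toLp 2 x⟫ = (b i).ofLp ⬝ᵥ x := by
    intro i x
    rw [show b i = WithLp.toLp 2 (b i).ofLp from rfl, EuclideanSpace.inner_toLp_toLp,
      star_trivial, dotProduct_comm]
  have hpar : ∀ x y : Fin n → ℝ, x ⬝ᵥ y = ∑ i, ((b i).ofLp ⬝ᵥ x) * ((b i).ofLp ⬝ᵥ y) := by
    intro x y
    have h := b.sum_inner_mul_inner (WithLp.toLp 2 x) (WithLp.toLp 2 y)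
    rw [EuclideanSpace.inner_toLp_toLp, star_trivial, dotProduct_comm] at h
    rw [← h]
    refine Finset.sum_congr rfl fun i _ => ?_
    rw [real_inner_comm, hin, hin]
  have hcov : ∀ i, (b i).ofLp ⬝ᵥ (covMat M ε *ᵥ M j) = (μ i + ε)⁻¹ * ((b i).ofLp ⬝ᵥ M j) := by
    intro i
    rw [dotProduct_mulVec, ← mulVec_transpose, isSymm_covMat M hε,
      covMat_mulVec_of_gram_mulVec M hε (by linarith [hμ i] : μ i + ε ≠ 0) (hb i),
      smul_dotProduct, smul_eq_mul]
  rw [hpar, hpar (M j) (M j), Finset.mul_sum]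
  refine Finset.sum_le_sum fun i _ => ?_
  rw [hcov]
  rcases eq_or_ne (μ i) 0 with h0 | h0
  · have hM : M *ᵥ (b i).ofLp = 0 := by
      have h := hb i
      rw [h0, zero_smul, ← mulVec_mulVec] at h
      have h2 : (M *ᵥ (b i).ofLp) ⬝ᵥ (M *ᵥ (b i).ofLp) = 0 := by
        rw [dotProduct_mulVec, ← mulVec_transpose, h, zero_dotProduct]
      exact dotProduct_self_eq_zero.mp h2
    have : (b i).ofLp ⬝ᵥ M j = 0 := by
      rw [dotProduct_comm]
      exact congrFun hM j
    simp [this]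
  · have hle : lam ≤ μ i := by
      refine hlam.2 ⟨h0, ?_⟩
      refine Module.End.hasEigenvalue_of_hasEigenvector (x := (b i).ofLp) ⟨?_, ?_⟩
      · rw [Module.End.mem_eigenspace_iff]
        exact hb i
      · intro h
        refine b.orthonormal.ne_zero i ?_
        ext k
        rw [h]
        rfl
    have h1 : 0 < μ i + ε := by linarith
    have h2 : lam * (μ i + ε)⁻¹ ≤ 1 := by
      rw [← div_eq_mul_inv, div_le_one h1]
      linarith
    nlinarith [mul_le_mul_of_nonneg_right h2 (mul_self_nonneg ((b i).ofLp ⬝ᵥ M j))]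

theorem pos_of_isSmallestNonzeroEigenvalue {lam : ℝ}
    (hlam : IsSmallestNonzeroEigenvalue (Mᵀ * M) lam) : 0 < lam := by
  obtain ⟨⟨h0, hev⟩, -⟩ := hlam
  obtain ⟨x, hx⟩ := hev.exists_hasEigenvector
  have h1 : (Mᵀ * M) *ᵥ x = lam • x := Module.End.mem_eigenspace_iff.mp hx.1
  have h2 : (M *ᵥ x) ⬝ᵥ (M *ᵥ x) = lam * (x ⬝ᵥ x) := by
    rw [dotProduct_mulVec, ← mulVec_transpose, mulVec_mulVec, h1, smul_dotProduct, smul_eq_mul]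
  have h3 : 0 < x ⬝ᵥ x := lt_of_le_of_ne (dotProduct_self_nonneg x)
    fun h => hx.2 (dotProduct_self_eq_zero.mp h.symm)
  have h4 : 0 ≤ (M *ᵥ x) ⬝ᵥ (M *ᵥ x) := dotProduct_self_nonneg _
  rw [h2] at h4
  exact lt_of_le_of_ne (nonneg_of_mul_nonneg_left h4 h3) h0.symm

/-- Summing the row bounds by the Cauchy–Schwarz inequality gains a factor `√N` over bounding each
`covNorm M ε (M j)` by `1`, at the cost of the condition number `‖M‖_F / √lam`. -/
theorem sum_covNorm_row_le (hε : 0 < ε) {lam : ℝ}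
    (hlam : IsSmallestNonzeroEigenvalue (Mᵀ * M) lam) :
    ∑ j, covNorm M ε (M j) ≤ Real.sqrt N * frobNorm M / Real.sqrt lam := by
  have hpos := pos_of_isSmallestNonzeroEigenvalue M hlam
  rw [le_div_iff₀ (Real.sqrt_pos.mpr hpos), mul_comm, Finset.mul_sum]
  calc ∑ j, Real.sqrt lam * covNorm M ε (M j) ≤ ∑ j, 1 * Real.sqrt (M j ⬝ᵥ M j) :=
        Finset.sum_le_sum fun j _ => by
          rw [one_mul]
          exact sqrt_mul_covNorm_row_le M hε hlam hpos j
    _ ≤ Real.sqrt (∑ j : Fin N, 1 ^ 2) * Real.sqrt (∑ j, Real.sqrt (M j ⬝ᵥ M j) ^ 2) :=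
        Real.sum_mul_le_sqrt_mul_sqrt _ _ _
    _ = Real.sqrt N * frobNorm M := by
        congr 2
        · simp
        · refine Finset.sum_congr rfl fun j _ => ?_
          rw [Real.sq_sqrt (dotProduct_self_nonneg _)]
          simp [dotProduct, sq]

end Covariance

/-! ### Descent directions of the preconditioned objective -/

/-- The `ℓ₁` norm is linear near `a` up to the coordinates where `a` vanishes. Hence moving from `a`
a little towards `b` decreases it if `b` is orthogonal to the gradient and the part of `b` on the
vanishing coordinates of `a` is smaller than `a`. -/
theorem exists_l1Norm_add_smul_lt {n : ℕ} (a b : Fin n → ℝ)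
    (hgrad : ∑ i, (SignType.sign (a i) : ℝ) * b i = 0)
    (hzero : ∑ i with a i = 0, |b i| < l1Norm a) :
    ∃ δ : ℝ, l1Norm (a + δ • (b - a)) < l1Norm a := by
  have hev : ∀ i, ∀ᶠ δ in nhdsWithin (0 : ℝ) (Set.Ioi 0),
      |a i + δ * (b i - a i)| = |a i| + δ * ((SignType.sign (a i) : ℝ) * b i
        + (if a i = 0 then |b i| else 0) - |a i|) := by
    intro i
    have hcont : Filter.Tendsto (fun δ : ℝ => a i + δ * (b i - a i)) (nhdsWithin 0 (Set.Ioi 0))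
        (nhds (a i)) := by
      refine Filter.Tendsto.mono_left ?_ nhdsWithin_le_nhds
      have : Continuous fun δ : ℝ => a i + δ * (b i - a i) := by fun_prop
      simpa using this.tendsto 0
    rcases lt_trichotomy (a i) 0 with h | h | h
    · filter_upwards [hcont.eventually_lt_const h] with δ hδ
      rw [abs_of_neg hδ, abs_of_neg h, sign_neg h, if_neg h.ne]
      simp only [SignType.coe_neg_one]
      ring
    · filter_upwards [self_mem_nhdsWithin] with δ hδ
      have hδ' : (0 : ℝ) < δ := hδ
      simp [h, abs_mul, abs_of_pos hδ']
    · filter_upwards [hcont.eventually_const_lt h] with δ hδ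
      rw [abs_of_pos hδ, abs_of_pos h, sign_pos h, if_neg h.ne']
      simp only [SignType.coe_one]
      ring
  obtain ⟨δ, hδ, hpos⟩ :=
    ((Filter.eventually_all.mpr hev).and self_mem_nhdsWithin).exists
  have hpos' : (0 : ℝ) < δ := hpos
  refine ⟨δ, ?_⟩
  have hsum : l1Norm (a + δ • (b - a))
      = l1Norm a + δ * (∑ i with a i = 0, |b i| - l1Norm a) := by
    simp only [l1Norm, Pi.add_apply, Pi.smul_apply, Pi.sub_apply, smul_eq_mul]
    rw [Finset.sum_congr rfl fun i _ => hδ i, Finset.sum_add_distrib, ← Finset.mul_sum,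
      Finset.sum_sub_distrib, Finset.sum_add_distrib, hgrad, zero_add, Finset.sum_filter]
  rw [hsum]
  nlinarith

section Descent

variable {N n : ℕ}

theorem lassoFails_of_descent {m : ℕ} {S : Matrix (Fin n) (Fin n) ℝ} {w u : Fin n → ℝ}
    {X : Fin m → EuclideanSpace ℝ (Fin n)}
    (hX : designMatrix X *ᵥ u = designMatrix X *ᵥ w)
    (hgrad : ∑ i, (SignType.sign ((Sᵀ *ᵥ w) i) : ℝ) * (Sᵀ *ᵥ u) i = 0)
    (hzero : ∑ i with (Sᵀ *ᵥ w) i = 0, |(Sᵀ *ᵥ u) i| < l1Norm (Sᵀ *ᵥ w)) :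
    LassoFails S w X := by
  obtain ⟨δ, hδ⟩ := exists_l1Norm_add_smul_lt _ _ hgrad hzero
  refine ⟨w + δ • (u - w), ?_, ?_⟩
  · rw [mulVec_add, mulVec_smul, mulVec_sub, hX, sub_self, smul_zero, add_zero]
  · rwa [mulVec_add, mulVec_smul, mulVec_sub]

/-- If the columns of `S` orthogonal to `w` are small on a subspace of dimension `3m` of the kernel
of `M`, then the preconditioned Lasso fails on `w` with high probability: in that subspace, a vector
`u` orthogonal to the gradient of `‖Sᵀ ·‖₁` at `w` and with `X u = X w` has norm at most
`4 √ε ‖w‖_Σ`. -/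
theorem one_sub_exp_le_sampleLaw_lassoFails {m : ℕ} (M : Matrix (Fin N) (Fin n) ℝ) {ε : ℝ}
    (hε : 0 < ε) (S : Matrix (Fin n) (Fin n) ℝ) (w : Fin n → ℝ)
    (U : Submodule ℝ (Fin n → ℝ)) (hker : ∀ u ∈ U, M *ᵥ u = 0)
    (hdim : 3 * m ≤ Module.finrank ℝ U) {κ : ℝ} (hκ0 : 0 ≤ κ)
    (hκ : ∀ u ∈ U, ∑ i with (Sᵀ *ᵥ w) i = 0, |(Sᵀ *ᵥ u) i| ≤ κ * Real.sqrt (u ⬝ᵥ u))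
    (hw : 4 * κ * Real.sqrt ε * covNorm M ε w < l1Norm (Sᵀ *ᵥ w)) :
    1 - Real.exp (-m) ≤ (sampleLaw (covMat M ε) m).real {X | LassoFails S w X} := by
  let φ : (Fin n → ℝ) →ₗ[ℝ] ℝ :=
    ∑ i, (SignType.sign ((Sᵀ *ᵥ w) i) : ℝ) • (LinearMap.proj i ∘ₗ Matrix.mulVecLin Sᵀ)
  have hφ : ∀ u, φ u = ∑ i, (SignType.sign ((Sᵀ *ᵥ w) i) : ℝ) * (Sᵀ *ᵥ u) i := by
    intro u
    simp [φ, LinearMap.sum_apply, -mulVecLin_transpose]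
  let T : (Fin n → ℝ) →ₗ[ℝ] EuclideanSpace ℝ (Fin n) :=
    (sqrtCov M ε : EuclideanSpace ℝ (Fin n) →ₗ[ℝ] EuclideanSpace ℝ (Fin n)) ∘ₗ
      ((WithLp.linearEquiv 2 ℝ (Fin n → ℝ)).symm : (Fin n → ℝ) →ₗ[ℝ] EuclideanSpace ℝ (Fin n))
  have hT : ∀ u, T u = sqrtCov M ε (WithLp.toLp 2 u) := fun u => rfl
  have hTinj : Function.Injective T :=
    (sqrtCov_injective M hε).comp (WithLp.linearEquiv 2 ℝ (Fin n → ℝ)).symm.injective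
  have hdim' : 3 * m ≤ Module.finrank ℝ ((U ⊓ φ.ker).map T) + 1 := by
    rw [← (Submodule.equivMapOfInjective T hTinj (U ⊓ φ.ker)).finrank_eq]
    have h1 := Submodule.finrank_sup_add_finrank_inf_eq U φ.ker
    have h2 := φ.finrank_range_add_finrank_ker
    have h3 : Module.finrank ℝ φ.range ≤ 1 := by
      simpa using Submodule.finrank_le φ.range
    have h4 := Submodule.finrank_le (U ⊔ φ.ker)
    omega
  have hbad := pi_stdGaussian_exists_mem_norm_le ((U ⊓ φ.ker).map T) hdim' (T w)
  set μ := Measure.pi fun _ : Fin m => stdGaussian (EuclideanSpace ℝ (Fin n))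
  have hlaw : sampleLaw (covMat M ε) m = μ.map fun g i => sqrtCov M ε (g i) := by
    simp only [sampleLaw, μ]
    rw [Measure.pi_map_pi
      (hμ := fun _ => by
        have := Measure.isProbabilityMeasure_map (μ := stdGaussian (EuclideanSpace ℝ (Fin n)))
          (f := sqrtCov M ε) (by fun_prop)
        infer_instance)
      (fun i => by fun_prop)]
    simp only [multivariateGaussian, zero_add]
    rfl
  have hsub : {g : Fin m → EuclideanSpace ℝ (Fin n) | LassoFails S w fun i => sqrtCov M ε (g i)}ᶜ ⊆
      {g | ¬ ∃ u ∈ (U ⊓ φ.ker).map T, (∀ i, ⟪g i, T w - u⟫ = 0) ∧ ‖u‖ ≤ 4 * ‖T w‖} := by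
    rintro g hg ⟨_, ⟨u, ⟨huU, huφ⟩, rfl⟩, h1, h2⟩
    refine hg (lassoFails_of_descent (u := u) ?_ ?_ ?_)
    · funext i
      have h := h1 i
      rw [inner_sub_right, sub_eq_zero, hT, hT, ← inner_sqrtCov_left, ← inner_sqrtCov_left] at h
      simp only [PiLp.inner_apply, RCLike.inner_apply, conj_trivial] at h
      simp only [mulVec, dotProduct, designMatrix, Matrix.of_apply]
      rw [Finset.sum_congr rfl fun j _ => mul_comm _ (u j),
        Finset.sum_congr rfl fun j _ => mul_comm _ (w j)]
      exact h.symm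
    · rw [← hφ]
      exact huφ
    · rw [hT, hT, norm_sqrtCov M hε, norm_sqrtCov M hε,
        covNorm_of_mulVec_eq_zero M hε (hker u huU), div_le_iff₀ (Real.sqrt_pos.mpr hε)] at h2
      calc _ ≤ κ * Real.sqrt (u ⬝ᵥ u) := hκ u huU
        _ ≤ κ * (4 * covNorm M ε w * Real.sqrt ε) := by gcongr
        _ = 4 * κ * Real.sqrt ε * covNorm M ε w := by ring
        _ < _ := hw
  have hprob : IsProbabilityMeasure (sampleLaw (covMat M ε) m) := by
    unfold sampleLaw
    infer_instance
  have h1 : μ {g | LassoFails S w fun i => sqrtCov M ε (g i)}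
      ≤ sampleLaw (covMat M ε) m {X | LassoFails S w X} := by
    rw [hlaw]
    exact Measure.le_map_apply (measurable_pi_lambda _ fun i =>
      (sqrtCov M ε).continuous.measurable.comp (measurable_pi_apply i)).aemeasurable _
  have h2 : μ.real {g | LassoFails S w fun i => sqrtCov M ε (g i)}
      ≤ (sampleLaw (covMat M ε) m).real {X | LassoFails S w X} :=
    ENNReal.toReal_mono (measure_ne_top _ _) h1
  have h3 : μ.real {g | LassoFails S w fun i => sqrtCov M ε (g i)}ᶜ ≤ Real.exp (-m) :=
    ENNReal.toReal_le_of_le_ofReal (Real.exp_pos _).le ((measure_mono hsub).trans hbad)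
  have h4 := measureReal_union_le (μ := μ) {g | LassoFails S w fun i => sqrtCov M ε (g i)}
    {g | LassoFails S w fun i => sqrtCov M ε (g i)}ᶜ
  rw [Set.union_compl_self, probReal_univ] at h4
  linarith

end Descent

/-! ### Anticoncentration of the signal -/

section Uniform

instance isProbabilityMeasure_unifLaw : IsProbabilityMeasure unifLaw :=
  cond_isProbabilityMeasure_of_finite (by simp) (by simp)

theorem ae_unifLaw_abs_le_one : ∀ᵐ x ∂unifLaw, |x| ≤ 1 := by
  have h : ∀ᵐ x ∂unifLaw, x ∈ Set.Icc (-1 : ℝ) 1 := ae_cond_mem measurableSet_Icc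
  filter_upwards [h] with x hx
  exact abs_le.mpr hx

theorem unifLaw_le_of_dist_le {A : Set ℝ} {α : ℝ}
    (hA : ∀ x ∈ A, ∀ y ∈ A, |x - y| ≤ 2 * α) : unifLaw A ≤ ENNReal.ofReal α := by
  have h1 : volume A ≤ ENNReal.ofReal (2 * α) := by
    refine (Real.volume_le_diam A).trans (Metric.ediam_le fun x hx y hy => ?_)
    rw [edist_dist, Real.dist_eq]
    exact ENNReal.ofReal_le_ofReal (hA x hx y hy)
  rw [unifLaw, cond_apply measurableSet_Icc, Real.volume_Icc]
  calc (ENNReal.ofReal (1 - -1))⁻¹ * volume (Set.Icc (-1) 1 ∩ A)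
      ≤ (ENNReal.ofReal 2)⁻¹ * ENNReal.ofReal (2 * α) := by
        rw [show (1 : ℝ) - -1 = 2 by norm_num]
        exact mul_le_mul_right ((measure_mono Set.inter_subset_right).trans h1) _
    _ = ENNReal.ofReal α := by
        rw [ENNReal.ofReal_mul (by norm_num), ← mul_assoc,
          ENNReal.inv_mul_cancel (by simp) (by simp), one_mul]

/-- Conditioning on all coordinates but one. -/
theorem measure_pi_le_of_update {ι : Type*} [Fintype ι] [DecidableEq ι] {μ : Measure ℝ}
    [IsProbabilityMeasure μ] {A : Set (ι → ℝ)} (hA : MeasurableSet A) (i : ι) {α : ℝ≥0∞}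
    (h : ∀ x : ι → ℝ, μ {y | Function.update x i y ∈ A} ≤ α) :
    Measure.pi (fun _ : ι => μ) A ≤ α := by
  have h1 : ∫⁻ x, A.indicator 1 x ∂(Measure.pi fun _ : ι => μ)
      ≤ ∫⁻ _, α ∂(Measure.pi fun _ : ι => μ) := by
    refine lintegral_le_of_lmarginal_le {i} (measurable_one.indicator hA) measurable_const ?_
    rw [lmarginal_singleton, lmarginal_singleton]
    intro x
    have h2 : (fun y => A.indicator (1 : (ι → ℝ) → ℝ≥0∞) (Function.update x i y))
        = {y | Function.update x i y ∈ A}.indicator 1 := rfl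
    simp only [h2]
    have h3 : MeasurableSet {y | Function.update x i y ∈ A} := hA.preimage (measurable_update x)
    rw [lintegral_indicator_one h3, lintegral_const, measure_univ, mul_one]
    exact h x
  rwa [lintegral_indicator_one hA, lintegral_const, measure_univ, mul_one] at h1

theorem prod_le_of_slice {α β : Type*} [MeasurableSpace α] [MeasurableSpace β] (μ : Measure α)
    (ν : Measure β) [IsProbabilityMeasure μ] [SFinite ν] {A : Set (α × β)}
    (hA : MeasurableSet A) {c : ℝ≥0∞} (h : ∀ x, ν (Prod.mk x ⁻¹' A) ≤ c) : μ.prod ν A ≤ c := by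
  rw [Measure.prod_apply hA]
  exact (lintegral_mono h).trans (by simp)

theorem prod_le_of_slice_symm {α β : Type*} [MeasurableSpace α] [MeasurableSpace β] (μ : Measure α)
    (ν : Measure β) [SFinite μ] [IsProbabilityMeasure ν] {A : Set (α × β)}
    (hA : MeasurableSet A) {c : ℝ≥0∞} (h : ∀ y, μ ((fun x => (x, y)) ⁻¹' A) ≤ c) :
    μ.prod ν A ≤ c := by
  rw [Measure.prod_apply_symm hA]
  exact (lintegral_mono h).trans (by simp)

end Uniform

theorem l1Norm_nonneg {n : ℕ} (x : Fin n → ℝ) : 0 ≤ l1Norm x :=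
  Finset.sum_nonneg fun _ _ => abs_nonneg _

theorem l1Norm_sub_le {n : ℕ} (x y : Fin n → ℝ) : l1Norm (x - y) ≤ l1Norm x + l1Norm y := by
  rw [l1Norm, l1Norm, l1Norm, ← Finset.sum_add_distrib]
  exact Finset.sum_le_sum fun i _ => abs_sub _ _

theorem l1Norm_smul {n : ℕ} (c : ℝ) (x : Fin n → ℝ) : l1Norm (c • x) = |c| * l1Norm x := by
  simp [l1Norm, abs_mul, Finset.mul_sum]

theorem l1Norm_pos_of_ne_zero {n : ℕ} {x : Fin n → ℝ} {i : Fin n} (h : x i ≠ 0) :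
    0 < l1Norm x :=
  (abs_pos.mpr h).trans_le
    (Finset.single_le_sum (f := fun i => |x i|) (fun _ _ => abs_nonneg _) (Finset.mem_univ i))

section Signal

variable {N n t : ℕ}

/-- The joint law of the coefficients `z₀, z, v` of a signal. -/
noncomputable def coeffLaw (n t : ℕ) : Measure (ℝ × (Fin t → ℝ) × (Fin n → ℝ)) :=
  unifLaw.prod ((Measure.pi (fun _ : Fin t => unifLaw)).prod
    (Measure.pi (fun _ : Fin n => unifLaw)))

instance isProbabilityMeasure_coeffLaw : IsProbabilityMeasure (coeffLaw n t) := by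
  unfold coeffLaw
  infer_instance

variable (M : Matrix (Fin N) (Fin n) ℝ) {ε : ℝ}

theorem continuous_signal (ε : ℝ) (R : Fin t → Fin N) (K : Finset (Fin n)) :
    Continuous fun p : ℝ × (Fin t → ℝ) × (Fin n → ℝ) => signal M ε R K p.1 p.2.1 p.2.2 := by
  unfold signal
  refine continuous_pi fun j => ?_
  simp only [Pi.add_apply, Pi.smul_apply, Finset.sum_apply, smul_eq_mul]
  split_ifs <;> fun_prop

theorem signal_update_entry_sub (R : Fin t → Fin N) {K : Finset (Fin n)} (z₀ : ℝ) (z : Fin t → ℝ)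
    (v : Fin n → ℝ) {j : Fin n} (hj : j ∈ K) (y y' : ℝ) :
    signal M ε R K z₀ z (Function.update v j y) - signal M ε R K z₀ z (Function.update v j y')
      = (z₀ * Real.sqrt ε * (y - y')) • Pi.single j 1 := by
  unfold signal
  rw [add_sub_add_right_eq_sub, ← smul_sub, ← smul_smul (z₀ * Real.sqrt ε)]
  congr 1
  ext i
  rcases eq_or_ne i j with rfl | h
  · simp [hj]
  · simp [h]

theorem signal_update_coeff_sub (R : Fin t → Fin N) (K : Finset (Fin n)) (z₀ : ℝ) (z : Fin t → ℝ)
    (v : Fin n → ℝ) (i : Fin t) (y y' : ℝ) :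
    signal M ε R K z₀ (Function.update z i y) v - signal M ε R K z₀ (Function.update z i y') v
      = (y - y') • (covNorm M ε (M (R i)))⁻¹ • M (R i) := by
  unfold signal
  rw [add_sub_add_left_eq_sub, ← Finset.sum_sub_distrib, Finset.sum_eq_single i]
  · rw [Function.update_self, Function.update_self, ← sub_smul, ← sub_div, smul_smul]
    rfl
  · intro l _ hl
    rw [Function.update_of_ne hl, Function.update_of_ne hl, sub_self]
  · simp

/-- A vector `s` that does not vanish on `K` is almost surely not orthogonal to the signal. -/
theorem ae_dotProduct_signal_ne_zero (hε : 0 < ε) (R : Fin t → Fin N) {K : Finset (Fin n)}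
    {s : Fin n → ℝ} {j : Fin n} (hj : j ∈ K) (hs : s j ≠ 0) :
    ∀ᵐ p ∂(coeffLaw n t), s ⬝ᵥ signal M ε R K p.1 p.2.1 p.2.2 ≠ 0 := by
  have hcont : Continuous fun p : ℝ × (Fin t → ℝ) × (Fin n → ℝ) =>
      s ⬝ᵥ signal M ε R K p.1 p.2.1 p.2.2 :=
    continuous_const.dotProduct (continuous_signal M ε R K)
  have hmeas : MeasurableSet {p : ℝ × (Fin t → ℝ) × (Fin n → ℝ) |
      s ⬝ᵥ signal M ε R K p.1 p.2.1 p.2.2 = 0} :=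
    (isClosed_eq hcont continuous_const).measurableSet
  have hz : ∀ᵐ z₀ ∂unifLaw, z₀ ≠ 0 := by
    rw [ae_iff]
    refine le_antisymm ((unifLaw_le_of_dist_le (α := 0) ?_).trans (by simp)) (zero_le)
    intro x hx y hy
    simp only [ne_eq, not_not, Set.mem_ofPred_eq] at hx hy
    simp [hx, hy]
  simp only [ae_iff, not_not, ne_eq]
  rw [coeffLaw, Measure.measure_prod_null hmeas]
  filter_upwards [hz] with z₀ hz₀
  refine le_antisymm (prod_le_of_slice _ _ (hmeas.preimage (by fun_prop)) fun z => ?_) (zero_le)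
  refine measure_pi_le_of_update
    ((hmeas.preimage measurable_prodMk_left).preimage measurable_prodMk_left) j fun v => ?_
  refine (unifLaw_le_of_dist_le (α := 0) ?_).trans (by simp)
  intro y hy y' hy'
  change s ⬝ᵥ signal M ε R K z₀ z (Function.update v j y) = 0 at hy
  change s ⬝ᵥ signal M ε R K z₀ z (Function.update v j y') = 0 at hy'
  have h : s ⬝ᵥ ((z₀ * Real.sqrt ε * (y - y')) • Pi.single j (1 : ℝ)) = 0 := by
    rw [← signal_update_entry_sub M R z₀ z v hj y y', dotProduct_sub, hy, hy', sub_zero]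
  have hsq : Real.sqrt ε ≠ 0 := (Real.sqrt_pos.mpr hε).ne'
  simp only [dotProduct_smul, dotProduct_single, mul_one, smul_eq_mul, mul_eq_zero, hz₀, hsq, hs,
    or_false, false_or] at h
  simp [h]

/-- Anticoncentration: the coefficient of the `i`-th row in the signal is uniform on an interval, so
`‖Sᵀ w‖₁` is rarely much smaller than the contribution of that row. -/
theorem coeffLaw_l1Norm_lt_le (R : Fin t → Fin N) (K : Finset (Fin n))
    (S : Matrix (Fin n) (Fin n) ℝ) (i : Fin t) (α : ℝ) :
    coeffLaw n t {p | l1Norm (Sᵀ *ᵥ signal M ε R K p.1 p.2.1 p.2.2)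
      < α * (l1Norm (Sᵀ *ᵥ M (R i)) / covNorm M ε (M (R i)))} ≤ ENNReal.ofReal α := by
  have hcont : Continuous fun p : ℝ × (Fin t → ℝ) × (Fin n → ℝ) =>
      l1Norm (Sᵀ *ᵥ signal M ε R K p.1 p.2.1 p.2.2) := by
    have h1 : Continuous fun x : Fin n → ℝ => l1Norm (Sᵀ *ᵥ x) := by
      unfold l1Norm
      refine continuous_finsetSum _ fun j _ => ?_
      exact ((continuous_apply j).comp (continuous_const.matrix_mulVec continuous_id)).abs
    exact h1.comp (continuous_signal M ε R K)
  have hmeas := (isOpen_lt hcont (continuous_const (y := α * (l1Norm (Sᵀ *ᵥ M (R i))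
    / covNorm M ε (M (R i)))))).measurableSet
  refine prod_le_of_slice _ _ hmeas fun z₀ => ?_
  refine prod_le_of_slice_symm _ _ (hmeas.preimage measurable_prodMk_left) fun v => ?_
  refine measure_pi_le_of_update
    ((hmeas.preimage measurable_prodMk_left).preimage measurable_prodMk_right) i fun z => ?_
  refine unifLaw_le_of_dist_le ?_
  intro y hy y' hy'
  change l1Norm (Sᵀ *ᵥ signal M ε R K z₀ (Function.update z i y) v) < _ at hy
  change l1Norm (Sᵀ *ᵥ signal M ε R K z₀ (Function.update z i y') v) < _ at hy'
  have h := l1Norm_sub_le (Sᵀ *ᵥ signal M ε R K z₀ (Function.update z i y) v)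
    (Sᵀ *ᵥ signal M ε R K z₀ (Function.update z i y') v)
  rw [← mulVec_sub, signal_update_coeff_sub, mulVec_smul, mulVec_smul, l1Norm_smul, l1Norm_smul,
    abs_of_nonneg (inv_nonneg.mpr (covNorm_nonneg M _)), inv_mul_eq_div] at h
  set Q := l1Norm (Sᵀ *ᵥ M (R i)) / covNorm M ε (M (R i))
  have hQ : 0 ≤ Q := div_nonneg (l1Norm_nonneg _) (covNorm_nonneg M _)
  have hQ0 : Q ≠ 0 := by
    intro h0
    rw [h0, mul_zero] at hy
    exact absurd hy (not_lt.mpr (l1Norm_nonneg _))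
  have hQpos : 0 < Q := lt_of_le_of_ne hQ hQ0.symm
  exact le_of_mul_le_mul_right (by linarith) hQpos

theorem ae_covNorm_signal_le (hε : 0 < ε) (R : Fin t → Fin N) (K : Finset (Fin n)) :
    ∀ᵐ p ∂(coeffLaw n t), covNorm M ε (signal M ε R K p.1 p.2.1 p.2.2)
      ≤ Real.sqrt K.card + t := by
  have h0 : ∀ᵐ p ∂(coeffLaw n t), |p.1| ≤ 1 :=
    Measure.quasiMeasurePreserving_fst.ae ae_unifLaw_abs_le_one
  have h1 : ∀ᵐ p ∂(coeffLaw n t), ∀ i, |p.2.1 i| ≤ 1 := by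
    have : ∀ᵐ z ∂(Measure.pi fun _ : Fin t => unifLaw), ∀ i, |z i| ≤ 1 :=
      ae_all_iff.mpr fun i =>
        (Measure.quasiMeasurePreserving_eval (fun _ : Fin t => unifLaw) i).ae ae_unifLaw_abs_le_one
    exact (Measure.quasiMeasurePreserving_fst.comp Measure.quasiMeasurePreserving_snd).ae this
  have h2 : ∀ᵐ p ∂(coeffLaw n t), ∀ j, |p.2.2 j| ≤ 1 := by
    have : ∀ᵐ v ∂(Measure.pi fun _ : Fin n => unifLaw), ∀ j, |v j| ≤ 1 :=
      ae_all_iff.mpr fun i =>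
        (Measure.quasiMeasurePreserving_eval (fun _ : Fin n => unifLaw) i).ae ae_unifLaw_abs_le_one
    exact (Measure.quasiMeasurePreserving_snd.comp Measure.quasiMeasurePreserving_snd).ae this
  filter_upwards [h0, h1, h2] with p hp0 hp1 hp2
  refine (covNorm_add_le M hε _ _).trans (add_le_add ?_ ?_)
  · rw [covNorm_smul M hε, abs_mul, abs_of_nonneg (Real.sqrt_nonneg ε)]
    set x : Fin n → ℝ := fun j => if j ∈ K then p.2.2 j else 0
    have hx : x ⬝ᵥ x ≤ K.card := by
      calc x ⬝ᵥ x ≤ ∑ j, if j ∈ K then (1 : ℝ) else 0 := by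
            refine Finset.sum_le_sum fun j _ => ?_
            simp only [x]
            split_ifs
            · have := sq_le_one_iff_abs_le_one (p.2.2 j) |>.mpr (hp2 j)
              nlinarith
            · simp
        _ = K.card := by simp
    calc |p.1| * Real.sqrt ε * covNorm M ε x
        ≤ 1 * Real.sqrt ε * (Real.sqrt K.card / Real.sqrt ε) := by
          refine mul_le_mul (mul_le_mul_of_nonneg_right hp0 (Real.sqrt_nonneg _)) ?_
            (covNorm_nonneg M x) (by positivity)
          refine (covNorm_le M hε x).trans ?_
          gcongr
      _ = Real.sqrt K.card := by
          have := (Real.sqrt_pos.mpr hε).ne'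
          field_simp
  · refine (covNorm_sum_le M hε _ _).trans ?_
    calc _ ≤ ∑ _i : Fin t, (1 : ℝ) := by
          refine Finset.sum_le_sum fun i _ => ?_
          rw [covNorm_smul M hε, abs_div]
          change |p.2.1 i| / |covNorm M ε (M (R i))| * covNorm M ε (M (R i)) ≤ 1
          rw [abs_of_nonneg (covNorm_nonneg M _)]
          rcases eq_or_ne (covNorm M ε (M (R i))) 0 with h | h
          · simp [h]
          · rw [div_mul_cancel₀ _ h]
            exact hp1 i
      _ = t := by simp

theorem nnz_signal_le {k : ℕ} (hM : ∀ i, nnz (M i) ≤ k) (R : Fin t → Fin N) {K : Finset (Fin n)}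
    (hK : K.card = k) (z₀ : ℝ) (z : Fin t → ℝ) (v : Fin n → ℝ) :
    nnz (signal M ε R K z₀ z v) ≤ k * (t + 1) := by
  classical
  have hsub : (Finset.univ.filter fun j => signal M ε R K z₀ z v j ≠ 0)
      ⊆ K ∪ Finset.univ.biUnion fun i => Finset.univ.filter fun j => M (R i) j ≠ 0 := by
    intro j hj
    by_contra hn
    simp only [Finset.mem_union, Finset.mem_biUnion, Finset.mem_univ, true_and,
      Finset.mem_filter, not_or, not_exists, not_not] at hn
    refine (Finset.mem_filter.mp hj).2 ?_
    simp [signal, hn.1, hn.2, Finset.sum_apply]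
  calc nnz (signal M ε R K z₀ z v) ≤ _ := Finset.card_le_card hsub
    _ ≤ k + ∑ _i : Fin t, k := by
        refine (Finset.card_union_le _ _).trans (add_le_add hK.le ?_)
        exact Finset.card_biUnion_le.trans (Finset.sum_le_sum fun i _ => hM (R i))
    _ = k * (t + 1) := by simp; ring

end Signal

/-! ### Counting the rows and coordinates of a signal -/

section Counting

theorem choose_sub_le {n s : ℕ} (hn : 0 < n) (hs : s ≤ n) (k : ℕ) :
    ((n - s).choose k : ℝ) ≤ n.choose k * (1 - (s : ℝ) / n) ^ k := by
  have hn' : (0 : ℝ) < n := by exact_mod_cast hn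
  have hs' : (0 : ℝ) ≤ 1 - (s : ℝ) / n := by
    rw [sub_nonneg, div_le_one hn']
    exact_mod_cast hs
  induction k with
  | zero => simp
  | succ k ih =>
    have h1 : (((n - s).choose (k + 1) : ℕ) : ℝ) * (k + 1)
        = (n - s).choose k * ((n - s - k : ℕ) : ℝ) := by
      exact_mod_cast Nat.choose_succ_right_eq (n - s) k
    have h2 : ((n.choose (k + 1) : ℕ) : ℝ) * (k + 1) = n.choose k * ((n - k : ℕ) : ℝ) := by
      exact_mod_cast Nat.choose_succ_right_eq n k
    have h3 : ((n - s - k : ℕ) : ℝ) ≤ ((n - k : ℕ) : ℝ) * (1 - (s : ℝ) / n) := by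
      rcases le_total (n - s) k with h | h
      · rw [Nat.sub_eq_zero_of_le h, Nat.cast_zero]
        positivity
      · rw [Nat.cast_sub h, Nat.cast_sub hs, Nat.cast_sub (h.trans (Nat.sub_le n s))]
        have : ((n : ℝ) - k) * (1 - s / n) - (n - s - k) = k * (s / n) := by
          field_simp
          ring
        have h4 : (0 : ℝ) ≤ k * (s / n) := by positivity
        linarith
    refine le_of_mul_le_mul_right ?_ (by positivity : (0 : ℝ) < (k : ℝ) + 1)
    calc (((n - s).choose (k + 1) : ℕ) : ℝ) * (k + 1)
        = (n - s).choose k * ((n - s - k : ℕ) : ℝ) := h1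
      _ ≤ (n.choose k * (1 - (s : ℝ) / n) ^ k) * (((n - k : ℕ) : ℝ) * (1 - (s : ℝ) / n)) := by
          gcongr
      _ = (n.choose k * ((n - k : ℕ) : ℝ)) * (1 - (s : ℝ) / n) ^ (k + 1) := by ring
      _ = n.choose (k + 1) * (1 - (s : ℝ) / n) ^ (k + 1) * (k + 1) := by rw [← h2]; ring

theorem one_sub_pow_le_exp {x y : ℝ} (hx : x ≤ 1) (hy : y ≤ x) (k : ℕ) :
    (1 - x) ^ k ≤ Real.exp (-(k * y)) := by
  calc (1 - x) ^ k ≤ Real.exp (-y) ^ k := by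
        refine pow_le_pow_left₀ (by linarith) ?_ k
        have := Real.add_one_le_exp (-y)
        linarith
    _ = Real.exp (-(k * y)) := by
        rw [← Real.exp_nat_mul, mul_neg]

theorem card_filter_powersetCard_forall_notMem_le {n : ℕ} (hn : 0 < n) (T : Finset (Fin n)) {τ : ℝ}
    (hτ : τ ≤ T.card) (k : ℕ) :
    (((Finset.powersetCard k Finset.univ).filter fun K => ∀ j ∈ K, j ∉ T).card : ℝ)
      ≤ n.choose k * Real.exp (-(k * (τ / n))) := by
  have hn' : (0 : ℝ) < n := by exact_mod_cast hn
  have hcard : T.card ≤ n := by simpa using Finset.card_le_univ T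
  have heq : ((Finset.powersetCard k Finset.univ).filter fun K => ∀ j ∈ K, j ∉ T)
      = Finset.powersetCard k Tᶜ := by
    ext K
    simp only [Finset.mem_filter, Finset.mem_powersetCard, Finset.subset_iff, Finset.mem_compl,
      Finset.mem_univ, implies_true, true_and]
    tauto
  rw [heq, Finset.card_powersetCard, Finset.card_compl, Fintype.card_fin]
  refine (choose_sub_le hn hcard k).trans ?_
  gcongr
  refine one_sub_pow_le_exp ?_ (by gcongr) k
  rw [div_le_one hn']
  exact_mod_cast hcard

theorem card_filter_forall_notMem_le {N t : ℕ} (hN : 0 < N) (ht : 0 < t) (B : Finset (Fin N))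
    {b : ℝ} (hB : min b N ≤ B.card) :
    ((Finset.univ.filter fun R : Fin t → Fin N => ∀ i, R i ∉ B).card : ℝ)
      ≤ N ^ t * Real.exp (-(t * b / N)) := by
  have hN' : (0 : ℝ) < N := by exact_mod_cast hN
  have hcard : B.card ≤ N := by simpa using Finset.card_le_univ B
  have heq : (Finset.univ.filter fun R : Fin t → Fin N => ∀ i, R i ∉ B)
      = Fintype.piFinset fun _ => Bᶜ := by
    ext R
    simp
  rw [heq, Fintype.card_piFinset_const, Finset.card_compl, Fintype.card_fin, Nat.cast_pow,
    Nat.cast_sub hcard]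
  have h1 : ((N : ℝ) - B.card) ^ t = N ^ t * (1 - (B.card : ℝ) / N) ^ t := by
    rw [← mul_pow]
    congr 1
    field_simp
  rw [h1]
  gcongr
  rcases le_total b N with h | h
  · rw [min_eq_left h] at hB
    rw [mul_div_assoc]
    refine one_sub_pow_le_exp ?_ (by gcongr) t
    rw [div_le_one hN']
    exact_mod_cast hcard
  · rw [min_eq_right h] at hB
    have : (B.card : ℝ) = N := le_antisymm (by exact_mod_cast hcard) hB
    rw [this, div_self hN'.ne', sub_self, zero_pow ht.ne']
    positivity

theorem exists_card_eq_forall_le {N : ℕ} (f : Fin N → ℝ) (q : ℕ) (hq : q ≤ N) :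
    ∃ B : Finset (Fin N), B.card = q ∧ ∀ i ∈ B, ∀ j ∉ B, f j ≤ f i := by
  induction q with
  | zero => exact ⟨∅, rfl, by simp⟩
  | succ q ih =>
    obtain ⟨B, hB, htop⟩ := ih (by omega)
    have hne : (Bᶜ).Nonempty := by
      rw [← Finset.card_pos, Finset.card_compl, Fintype.card_fin]
      omega
    obtain ⟨x, hx, hmax⟩ := Finset.exists_max_image Bᶜ f hne
    refine ⟨insert x B, ?_, ?_⟩
    · rw [Finset.card_insert_of_notMem (Finset.mem_compl.mp hx), hB]
    · intro i hi j hj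
      simp only [Finset.mem_insert, not_or] at hi hj
      rcases hi with rfl | hi
      · exact hmax j (Finset.mem_compl.mpr hj.2)
      · exact htop i hi j hj.2

/-- For `B` take the `⌊b⌋` largest values, and for `B'` one more: every element of `B'` still
dominates all values outside `B`, while `B'` has at least `b` elements. -/
theorem exists_dominating_sets {N : ℕ} (f : Fin N → ℝ) {b : ℝ} (hb : 0 ≤ b) :
    ∃ B B' : Finset (Fin N), (B.card : ℝ) ≤ b ∧ min b N ≤ (B'.card : ℝ) ∧
      ∀ i ∈ B', ∀ j ∉ B, f j ≤ f i := by
  rcases Nat.lt_or_ge ⌊b⌋₊ N with h | h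
  · obtain ⟨B, hB, htop⟩ := exists_card_eq_forall_le f ⌊b⌋₊ h.le
    have hne : (Bᶜ).Nonempty := by
      rw [← Finset.card_pos, Finset.card_compl, Fintype.card_fin]
      omega
    obtain ⟨x, hx, hmax⟩ := Finset.exists_max_image Bᶜ f hne
    refine ⟨B, insert x B, ?_, ?_, ?_⟩
    · rw [hB]
      exact Nat.floor_le hb
    · rw [Finset.card_insert_of_notMem (Finset.mem_compl.mp hx), hB]
      push_cast
      exact (min_le_left _ _).trans (Nat.lt_floor_add_one b).le
    · intro i hi j hj
      rcases Finset.mem_insert.mp hi with rfl | hi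
      · exact hmax j (Finset.mem_compl.mpr hj)
      · exact htop i hi j hj
  · refine ⟨Finset.univ, Finset.univ, ?_, ?_, by simp⟩
    · rw [Finset.card_univ, Fintype.card_fin]
      exact (Nat.cast_le.mpr h).trans (Nat.floor_le hb)
    · simp

end Counting

section SignalLaw

variable {N n : ℕ} (M : Matrix (Fin N) (Fin n) ℝ) (ε : ℝ)

theorem signalLaw_apply (k t : ℕ) (A : Set (Fin n → ℝ)) :
    signalLaw M ε k t A = ((N ^ t * n.choose k : ℕ) : ℝ≥0∞)⁻¹ *
      ∑ R : Fin t → Fin N, ∑ K ∈ Finset.powersetCard k Finset.univ,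
        (coeffLaw n t).map (fun p => signal M ε R K p.1 p.2.1 p.2.2) A := by
  simp [signalLaw, coeffLaw, Measure.finsetSum_apply]

theorem isProbabilityMeasure_signalLaw (hN : 0 < N) {k : ℕ} (hk : k ≤ n) (t : ℕ) :
    IsProbabilityMeasure (signalLaw M ε k t) := by
  refine ⟨?_⟩
  have h : ∀ (R : Fin t → Fin N) (K : Finset (Fin n)),
      (coeffLaw n t).map (fun p => signal M ε R K p.1 p.2.1 p.2.2) Set.univ = 1 := fun R K => by
    rw [Measure.map_apply (continuous_signal M ε R K).measurable MeasurableSet.univ,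
      Set.preimage_univ, measure_univ]
  simp only [signalLaw_apply, h, Finset.sum_const, Finset.card_univ, Finset.card_powersetCard,
    Fintype.card_fun, Fintype.card_fin, nsmul_eq_mul, mul_one]
  rw [← Nat.cast_mul]
  refine ENNReal.inv_mul_cancel ?_ (ENNReal.natCast_ne_top _)
  have : 0 < N ^ t * n.choose k := Nat.mul_pos (pow_pos hN t) (Nat.choose_pos hk)
  exact_mod_cast this.ne'

/-- If `A` has probability at least `1 - δ` conditionally on `R` and `K` whenever `R` satisfies `P`
and `K` satisfies `Q`, then the failure probabilities of `P`, `Q` and `A` add up. -/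
theorem le_signalLaw_real (hN : 0 < N) {k : ℕ} (hk : k ≤ n) {t : ℕ} {A : Set (Fin n → ℝ)}
    {P : (Fin t → Fin N) → Prop} {Q : Finset (Fin n) → Prop} [DecidablePred P] [DecidablePred Q]
    {δ β γ : ℝ} (hδ0 : 0 ≤ δ) (hδ1 : δ ≤ 1)
    (hA : ∀ R K, P R → Q K → K.card = k →
      1 - δ ≤ (coeffLaw n t).real {p | signal M ε R K p.1 p.2.1 p.2.2 ∈ A})
    (hP : ((Finset.univ.filter fun R => ¬ P R).card : ℝ) ≤ N ^ t * β)
    (hQ : (((Finset.powersetCard k Finset.univ).filter fun K => ¬ Q K).card : ℝ)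
      ≤ n.choose k * γ) :
    1 - β - γ - δ ≤ (signalLaw M ε k t).real A := by
  set 𝒦 : Finset (Finset (Fin n)) := Finset.powersetCard k Finset.univ
  have hR0 : (0 : ℝ) < N ^ t := by
    have : (0 : ℝ) < N := by exact_mod_cast hN
    positivity
  have hK0 : (0 : ℝ) < n.choose k := by exact_mod_cast Nat.choose_pos hk
  set x : ℝ := ((Finset.univ.filter P).card : ℝ) / N ^ t
  set y : ℝ := ((𝒦.filter Q).card : ℝ) / n.choose k
  have hx : 1 - β ≤ x ∧ x ≤ 1 := by
    have h := Finset.card_filter_add_card_filter_not (s := Finset.univ) P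
    rw [Finset.card_univ, Fintype.card_fun, Fintype.card_fin, Fintype.card_fin] at h
    have h' : ((Finset.univ.filter P).card : ℝ) + (Finset.univ.filter fun R => ¬ P R).card
        = N ^ t := by exact_mod_cast h
    constructor
    · rw [le_div_iff₀ hR0]
      nlinarith
    · rw [div_le_one hR0]
      have : (0 : ℝ) ≤ (Finset.univ.filter fun R => ¬ P R).card := by positivity
      linarith
  have hy : 1 - γ ≤ y ∧ y ≤ 1 := by
    have h := Finset.card_filter_add_card_filter_not (s := 𝒦) Q
    rw [Finset.card_powersetCard, Finset.card_univ, Fintype.card_fin] at h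
    have h' : ((𝒦.filter Q).card : ℝ) + (𝒦.filter fun K => ¬ Q K).card = n.choose k := by
      exact_mod_cast h
    constructor
    · rw [le_div_iff₀ hK0]
      nlinarith
    · rw [div_le_one hK0]
      have : (0 : ℝ) ≤ (𝒦.filter fun K => ¬ Q K).card := by positivity
      linarith
  have hx0 : 0 ≤ x := by positivity
  have hy0 : 0 ≤ y := by positivity
  have hmain : x * y * (1 - δ) ≤ (signalLaw M ε k t).real A := by
    have hle : ∀ R K, P R → Q K → K.card = k → ENNReal.ofReal (1 - δ)
        ≤ (coeffLaw n t).map (fun p => signal M ε R K p.1 p.2.1 p.2.2) A := by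
      intro R K h1 h2 h3
      refine le_trans ?_
        (Measure.le_map_apply (continuous_signal M ε R K).measurable.aemeasurable A)
      exact ENNReal.ofReal_le_of_le_toReal (hA R K h1 h2 h3)
    have hsum : (((Finset.univ.filter P).card * (𝒦.filter Q).card : ℕ) : ℝ≥0∞)
          * ENNReal.ofReal (1 - δ)
        ≤ ∑ R : Fin t → Fin N, ∑ K ∈ 𝒦,
          (coeffLaw n t).map (fun p => signal M ε R K p.1 p.2.1 p.2.2) A := by
      calc (((Finset.univ.filter P).card * (𝒦.filter Q).card : ℕ) : ℝ≥0∞)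
            * ENNReal.ofReal (1 - δ)
          = ∑ R ∈ Finset.univ.filter P, ∑ K ∈ 𝒦.filter Q, ENNReal.ofReal (1 - δ) := by
            simp [mul_assoc]
        _ ≤ ∑ R ∈ Finset.univ.filter P, ∑ K ∈ 𝒦.filter Q,
            (coeffLaw n t).map (fun p => signal M ε R K p.1 p.2.1 p.2.2) A := by
            refine Finset.sum_le_sum fun R hR => Finset.sum_le_sum fun K hK => ?_
            have hK' := Finset.mem_filter.mp hK
            exact hle R K (Finset.mem_filter.mp hR).2 hK'.2
              (Finset.mem_powersetCard.mp hK'.1).2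
        _ ≤ ∑ R : Fin t → Fin N, ∑ K ∈ 𝒦,
            (coeffLaw n t).map (fun p => signal M ε R K p.1 p.2.1 p.2.2) A := by
            refine (Finset.sum_le_sum fun R _ =>
              Finset.sum_le_sum_of_subset (Finset.filter_subset Q 𝒦)).trans ?_
            exact Finset.sum_le_sum_of_subset (Finset.filter_subset P _)
    have hprob := isProbabilityMeasure_signalLaw M ε hN hk t
    have h := mul_le_mul_right hsum ((N ^ t * n.choose k : ℕ) : ℝ≥0∞)⁻¹
    rw [← signalLaw_apply] at h
    have h' := ENNReal.toReal_mono (measure_ne_top _ _) h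
    rw [ENNReal.toReal_mul, ENNReal.toReal_inv, ENNReal.toReal_mul,
      ENNReal.toReal_ofReal (by linarith), ENNReal.toReal_natCast, ENNReal.toReal_natCast] at h'
    refine le_trans (le_of_eq ?_) h'
    simp only [x, y]
    push_cast
    field_simp
  have h1 : 1 - β - γ ≤ x * y := by
    nlinarith [mul_nonneg (sub_nonneg.mpr hx.2) (sub_nonneg.mpr hy.2)]
  have h2 : x * y ≤ 1 := mul_le_one₀ hx.2 hy0 hy.2
  nlinarith

end SignalLaw

/-! ### Signals on which the preconditioned Lasso fails -/

section Failure

variable {N n : ℕ} (M : Matrix (Fin N) (Fin n) ℝ) {ε : ℝ}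

/-- The vectors of the kernel of `M` that vanish on `C`. -/
def kerVanishing (M : Matrix (Fin N) (Fin n) ℝ) (C : Finset (Fin n)) :
    Submodule ℝ (Fin n → ℝ) :=
  LinearMap.ker (M.mulVecLin.prod (LinearMap.funLeft ℝ ℝ (Subtype.val : C → Fin n)))

theorem mem_kerVanishing {C : Finset (Fin n)} {u : Fin n → ℝ} :
    u ∈ kerVanishing M C ↔ M *ᵥ u = 0 ∧ ∀ j ∈ C, u j = 0 := by
  rw [kerVanishing, LinearMap.ker_prod, Submodule.mem_inf, LinearMap.mem_ker, LinearMap.mem_ker,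
    mulVecLin_apply, funext_iff (f := LinearMap.funLeft ℝ ℝ (Subtype.val : C → Fin n) u)]
  exact and_congr_right' Subtype.forall

theorem le_finrank_kerVanishing (C : Finset (Fin n)) :
    n ≤ Module.finrank ℝ (kerVanishing M C) + (N + C.card) := by
  set L := M.mulVecLin.prod (LinearMap.funLeft ℝ ℝ (Subtype.val : C → Fin n))
  have h1 := L.finrank_range_add_finrank_ker
  have h2 := Submodule.finrank_le L.range
  simp only [Module.finrank_prod, Module.finrank_fintype_fun_eq_card, Fintype.card_fin,
    Fintype.card_coe] at h1 h2
  change n ≤ Module.finrank ℝ L.ker + _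
  omega

theorem transpose_mulVec_apply (S : Matrix (Fin n) (Fin n) ℝ) (x : Fin n → ℝ) (i : Fin n) :
    (Sᵀ *ᵥ x) i = Sᵀ i ⬝ᵥ x := rfl

/-- When no column of `S` is orthogonal to `w`, the objective is differentiable at `w`, and every
direction of descent will do. -/
theorem lassoFails_of_forall_ne_zero {m : ℕ} (hε : 0 < ε) (S : Matrix (Fin n) (Fin n) ℝ)
    (hn : 0 < n) (hdim : 3 * m + N ≤ n) {w : Fin n → ℝ} (hw : ∀ i, (Sᵀ *ᵥ w) i ≠ 0) :
    1 - Real.exp (-m) ≤ (sampleLaw (covMat M ε) m).real {X | LassoFails S w X} := by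
  refine one_sub_exp_le_sampleLaw_lassoFails M hε S w (kerVanishing M ∅)
    (fun u hu => ((mem_kerVanishing M).mp hu).1) ?_ le_rfl (fun u _ => ?_) ?_
  · have := le_finrank_kerVanishing M ∅
    rw [Finset.card_empty] at this
    omega
  · simp [hw]
  · simpa using l1Norm_pos_of_ne_zero (hw ⟨0, hn⟩)

/-- The sparse columns of `S` are small on the kernel vectors that vanish on the set `C` provided by
erasure-robustness, in terms of the size of `S` on the rows outside `B`. -/
theorem sum_abs_transpose_mulVec_le {S : Matrix (Fin n) (Fin n) ℝ} {B : Finset (Fin N)}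
    {C : Finset (Fin n)} {η τ Q : ℝ} (hη : 0 ≤ η) (hQ0 : 0 ≤ Q)
    (hC : ∀ x : Fin n → ℝ, τ ≤ (nnz x : ℝ) ∨
        Real.sqrt (∑ j ∈ Cᶜ, x j ^ 2) ≤ η * ‖fun i : {i : Fin N // i ∉ B} => (M *ᵥ x) i‖)
    (hQ : ∀ j ∉ B, l1Norm (Sᵀ *ᵥ M j) ≤ covNorm M ε (M j) * Q)
    {I : Finset (Fin n)} (hI : ∀ i ∈ I, ¬ τ ≤ (nnz (Sᵀ i) : ℝ)) {u : Fin n → ℝ}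
    (hu : ∀ j ∈ C, u j = 0) :
    ∑ i ∈ I, |(Sᵀ *ᵥ u) i|
      ≤ η * ((∑ j, covNorm M ε (M j)) * Q) * Real.sqrt (u ⬝ᵥ u) := by
  have h1 : ∀ i ∈ I, |(Sᵀ *ᵥ u) i|
      ≤ (η * ∑ j ∈ Bᶜ, |(M *ᵥ Sᵀ i) j|) * Real.sqrt (u ⬝ᵥ u) := by
    intro i hi
    have hdot : (Sᵀ *ᵥ u) i = ∑ j ∈ Cᶜ, Sᵀ i j * u j := by
      rw [transpose_mulVec_apply, dotProduct, ← Finset.sum_add_sum_compl C]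
      rw [Finset.sum_eq_zero fun j hj => by rw [hu j hj, mul_zero], zero_add]
    have hcs : |(Sᵀ *ᵥ u) i|
        ≤ Real.sqrt (∑ j ∈ Cᶜ, Sᵀ i j ^ 2) * Real.sqrt (∑ j ∈ Cᶜ, u j ^ 2) := by
      rw [hdot, ← Real.sqrt_mul (Finset.sum_nonneg fun _ _ => sq_nonneg _)]
      exact Real.abs_le_sqrt (Finset.sum_mul_sq_le_sq_mul_sq _ _ _)
    have hsup : ‖fun j : {j : Fin N // j ∉ B} => (M *ᵥ Sᵀ i) j‖ ≤ ∑ j ∈ Bᶜ, |(M *ᵥ Sᵀ i) j| := by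
      rw [pi_norm_le_iff_of_nonneg (Finset.sum_nonneg fun _ _ => abs_nonneg _)]
      intro j
      exact Finset.single_le_sum (f := fun j => |(M *ᵥ Sᵀ i) j|) (fun _ _ => abs_nonneg _)
        (Finset.mem_compl.mpr j.2)
    refine hcs.trans (mul_le_mul ?_ (Real.sqrt_le_sqrt ?_) (Real.sqrt_nonneg _) ?_)
    · exact ((hC (Sᵀ i)).resolve_left (hI i hi)).trans (by gcongr)
    · simp only [dotProduct, ← sq]
      exact Finset.sum_le_sum_of_subset_of_nonneg (Finset.subset_univ _) fun _ _ _ => sq_nonneg _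
    · exact mul_nonneg hη (Finset.sum_nonneg fun _ _ => abs_nonneg _)
  have h2 : ∑ i ∈ I, ∑ j ∈ Bᶜ, |(M *ᵥ Sᵀ i) j| ≤ (∑ j, covNorm M ε (M j)) * Q := by
    rw [Finset.sum_comm, Finset.sum_mul]
    calc ∑ j ∈ Bᶜ, ∑ i ∈ I, |(M *ᵥ Sᵀ i) j| ≤ ∑ j ∈ Bᶜ, covNorm M ε (M j) * Q := by
          refine Finset.sum_le_sum fun j hj => ?_
          refine le_trans ?_ (hQ j (Finset.mem_compl.mp hj))
          refine (Finset.sum_le_sum_of_subset_of_nonneg (Finset.subset_univ I)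
            fun _ _ _ => abs_nonneg _).trans (le_of_eq ?_)
          refine Finset.sum_congr rfl fun i _ => ?_
          rw [transpose_mulVec_apply, dotProduct_comm]
          rfl
      _ ≤ ∑ j, covNorm M ε (M j) * Q :=
          Finset.sum_le_sum_of_subset_of_nonneg (Finset.subset_univ _)
            fun j _ _ => mul_nonneg (covNorm_nonneg M _) hQ0
  refine (Finset.sum_le_sum h1).trans ?_
  rw [← Finset.sum_mul, ← Finset.mul_sum]
  gcongr

/-- The failure of the Lasso on a signal `w` that is orthogonal to no dense column of `S` and has an
objective value not too small compared to the rows outside `B`. The exponent `105 / 2` is `51` from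
the lower bound on the objective, plus `1` from `‖w‖_Σ ≤ 2n`, plus `1 / 2` from the sum over the
rows of `M`. -/
theorem lassoFails_of_erasure {m : ℕ} (hε : 0 < ε) {S : Matrix (Fin n) (Fin n) ℝ} (hNn : N ≤ n)
    (hn : 0 < n)
    {B : Finset (Fin N)} {C : Finset (Fin n)} {η τ Q lam : ℝ} (hη : 0 < η) (hQ0 : 0 ≤ Q)
    (hlam : IsSmallestNonzeroEigenvalue (Mᵀ * M) lam)
    (hC : ∀ x : Fin n → ℝ, τ ≤ (nnz x : ℝ) ∨
        Real.sqrt (∑ j ∈ Cᶜ, x j ^ 2) ≤ η * ‖fun i : {i : Fin N // i ∉ B} => (M *ᵥ x) i‖)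
    (hQ : ∀ j ∉ B, l1Norm (Sᵀ *ᵥ M j) ≤ covNorm M ε (M j) * Q)
    (hdim : 3 * m + (N + C.card) ≤ n)
    (hsmall : 9 * (n : ℝ) ^ (105 / 2 : ℝ) * η * frobNorm M * Real.sqrt (ε / lam) < 1)
    {w : Fin n → ℝ} (hdense : ∀ i, τ ≤ (nnz (Sᵀ i) : ℝ) → (Sᵀ *ᵥ w) i ≠ 0)
    (hpos : 0 < l1Norm (Sᵀ *ᵥ w)) (hnorm : covNorm M ε w ≤ 2 * n)
    (hlarge : ((n : ℝ) ^ 51)⁻¹ * Q ≤ l1Norm (Sᵀ *ᵥ w)) :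
    1 - Real.exp (-m) ≤ (sampleLaw (covMat M ε) m).real {X | LassoFails S w X} := by
  have hn' : (0 : ℝ) < n := by exact_mod_cast hn
  have hlam0 := pos_of_isSmallestNonzeroEigenvalue M hlam
  have hN0 : 0 ≤ ∑ j, covNorm M ε (M j) := Finset.sum_nonneg fun j _ => covNorm_nonneg M _
  refine one_sub_exp_le_sampleLaw_lassoFails M hε S w (kerVanishing M C)
    (fun u hu => ((mem_kerVanishing M).mp hu).1) ?_
    (κ := η * ((∑ j, covNorm M ε (M j)) * Q)) (by positivity) (fun u hu => ?_) ?_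
  · have := le_finrank_kerVanishing M C
    omega
  · refine sum_abs_transpose_mulVec_le M hη.le hQ0 hC hQ (fun i hi => ?_)
      ((mem_kerVanishing M).mp hu).2
    exact fun h => hdense i h (Finset.mem_filter.mp hi).2
  · have hF : 0 ≤ frobNorm M := Real.sqrt_nonneg _
    have hle : 4 * (η * ((∑ j, covNorm M ε (M j)) * Q)) * Real.sqrt ε * covNorm M ε w
        ≤ 4 * (η * ((Real.sqrt n * frobNorm M / Real.sqrt lam) * Q)) * Real.sqrt ε * (2 * n) := by
      refine mul_le_mul ?_ hnorm (covNorm_nonneg M w) (by positivity)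
      gcongr
      refine (sum_covNorm_row_le M hε hlam).trans ?_
      gcongr
    have hpow : (n : ℝ) ^ (105 / 2 : ℝ) = n ^ 51 * (n * Real.sqrt n) := by
      rw [Real.sqrt_eq_rpow, show (105 / 2 : ℝ) = ((51 : ℕ) : ℝ) + (1 + 1 / 2) by norm_num,
        Real.rpow_add hn', Real.rpow_natCast, Real.rpow_add hn', Real.rpow_one]
    rw [hpow, Real.sqrt_div hε.le] at hsmall
    set Y := n * Real.sqrt n * η * frobNorm M * (Real.sqrt ε / Real.sqrt lam) with hY
    have hYle : Y ≤ ((n : ℝ) ^ 51)⁻¹ / 9 := by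
      rw [le_div_iff₀ (by norm_num), ← one_div, le_div_iff₀ (by positivity), hY]
      linarith
    have heq : 4 * (η * ((Real.sqrt n * frobNorm M / Real.sqrt lam) * Q)) * Real.sqrt ε * (2 * n)
        = 8 * Y * Q := by
      rw [hY]
      ring
    rw [heq] at hle
    have h8 : 8 * Y * Q ≤ 8 / 9 * (((n : ℝ) ^ 51)⁻¹ * Q) := by
      nlinarith [mul_le_mul_of_nonneg_right hYle hQ0]
    have hQn : 0 ≤ ((n : ℝ) ^ 51)⁻¹ * Q := by positivity
    linarith

end Failure

/-! ### The failure probability -/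

section Conclusion

variable {N n : ℕ}

theorem exists_entry_ne_zero_of_isUnit {S : Matrix (Fin n) (Fin n) ℝ} (hS : IsUnit S) (i : Fin n) :
    ∃ j, S j i ≠ 0 := by
  by_contra! h
  have h1 : S *ᵥ Pi.single i 1 = S *ᵥ 0 := by
    rw [mulVec_single_one, mulVec_zero]
    exact funext h
  have h2 := congrFun (mulVec_injective_of_isUnit hS h1) i
  simp at h2

theorem one_sub_le_real_of_ae {α : Type*} [MeasurableSpace α] {μ : Measure α}
    [IsProbabilityMeasure μ] {A B : Set α} {δ : ℝ} (hδ : 0 ≤ δ) (hB : μ B ≤ ENNReal.ofReal δ)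
    (h : ∀ᵐ x ∂μ, x ∉ B → x ∈ A) : 1 - δ ≤ μ.real A := by
  have h1 : μ Aᶜ ≤ μ B := measure_mono_ae (by
    filter_upwards [h] with x hx hxA
    by_contra hxB
    exact hxA (hx hxB))
  have h2 : μ.real Aᶜ ≤ δ := ENNReal.toReal_le_of_le_ofReal hδ (h1.trans hB)
  have h3 := measureReal_union_le (μ := μ) A Aᶜ
  rw [Set.union_compl_self, probReal_univ] at h3
  linarith

/-- Without a sparsity constraint, uniform signals on the cube defeat every preconditioner. -/
theorem ae_pi_unifLaw_lassoFails {m : ℕ} (M : Matrix (Fin N) (Fin n) ℝ) {ε : ℝ} (hε : 0 < ε)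
    (hn : 0 < n) (hdim : 3 * m + N ≤ n) {S : Matrix (Fin n) (Fin n) ℝ} (hS : IsUnit S) :
    ∀ᵐ w ∂(Measure.pi fun _ : Fin n => unifLaw),
      1 - Real.exp (-m) ≤ (sampleLaw (covMat M ε) m).real {X | LassoFails S w X} := by
  have h : ∀ i, ∀ᵐ w ∂(Measure.pi fun _ : Fin n => unifLaw), (Sᵀ *ᵥ w) i ≠ 0 := by
    intro i
    obtain ⟨j, hj⟩ := exists_entry_ne_zero_of_isUnit hS i
    have hcont : Continuous fun w : Fin n → ℝ => (Sᵀ *ᵥ w) i :=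
      (continuous_apply i).comp (continuous_const.matrix_mulVec continuous_id)
    simp only [ae_iff, not_not, ne_eq]
    refine le_antisymm (measure_pi_le_of_update
      (isClosed_eq hcont continuous_const).measurableSet j fun w => ?_) (zero_le)
    refine (unifLaw_le_of_dist_le (α := 0) ?_).trans (by simp)
    intro y hy y' hy'
    change (Sᵀ *ᵥ Function.update w j y) i = 0 at hy
    change (Sᵀ *ᵥ Function.update w j y') i = 0 at hy'
    have hdiff : Function.update w j y - Function.update w j y' = Pi.single j (y - y') := by
      ext l
      rcases eq_or_ne l j with rfl | h
      · simp
      · simp [h]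
    have h0 : (Sᵀ *ᵥ Pi.single j (y - y')) i = 0 := by
      rw [← hdiff, mulVec_sub, Pi.sub_apply, hy, hy', sub_zero]
    rw [mulVec_single] at h0
    have h1 : S j i = 0 ∨ y - y' = 0 := by simpa using h0
    simp [h1.resolve_left hj]
  filter_upwards [ae_all_iff.mpr h] with w hw
  exact lassoFails_of_forall_ne_zero M hε S hn hdim hw

/-- The failure probability of the signals conditionally on rows `R`, one of which dominates the
rows outside `B`, and on a set `K` that meets the support of every dense column of `S`. The error
term comes from anticoncentration and is needed only in the presence of a sparse column. -/
theorem one_sub_le_coeffLaw_lassoFails {m t : ℕ} (M : Matrix (Fin N) (Fin n) ℝ) {ε : ℝ}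
    (hε : 0 < ε) {S : Matrix (Fin n) (Fin n) ℝ} (hS : IsUnit S) (hNn : N ≤ n) (hn : 0 < n)
    {B : Finset (Fin N)} {C : Finset (Fin n)} {η τ lam : ℝ} (hη : 0 < η)
    (hlam : IsSmallestNonzeroEigenvalue (Mᵀ * M) lam)
    (hC : ∀ x : Fin n → ℝ, τ ≤ (nnz x : ℝ) ∨
        Real.sqrt (∑ j ∈ Cᶜ, x j ^ 2) ≤ η * ‖fun i : {i : Fin N // i ∉ B} => (M *ᵥ x) i‖)
    (hdim : 3 * m + (N + C.card) ≤ n)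
    (hsmall : 9 * (n : ℝ) ^ (105 / 2 : ℝ) * η * frobNorm M * Real.sqrt (ε / lam) < 1)
    (ht : t ≤ n) {R : Fin t → Fin N} {K : Finset (Fin n)} (hKne : K.Nonempty)
    (hR : ∃ i, ∀ j ∉ B, l1Norm (Sᵀ *ᵥ M j) / covNorm M ε (M j)
      ≤ l1Norm (Sᵀ *ᵥ M (R i)) / covNorm M ε (M (R i)))
    (hK : ∀ i, τ ≤ (nnz (Sᵀ i) : ℝ) → ∃ j ∈ K, S j i ≠ 0) {δ : ℝ} (hδ : 0 ≤ δ)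
    (hδ' : (∃ i, ¬ τ ≤ (nnz (Sᵀ i) : ℝ)) → ((n : ℝ) ^ 51)⁻¹ ≤ δ) :
    1 - δ ≤ (coeffLaw n t).real {p | 1 - Real.exp (-m) ≤ (sampleLaw (covMat M ε) m).real
      {X | LassoFails S (signal M ε R K p.1 p.2.1 p.2.2) X}} := by
  have hdense : ∀ᵐ p ∂(coeffLaw n t), ∀ i, τ ≤ (nnz (Sᵀ i) : ℝ) →
      (Sᵀ *ᵥ signal M ε R K p.1 p.2.1 p.2.2) i ≠ 0 := by
    refine ae_all_iff.mpr fun i => ?_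
    by_cases hi : τ ≤ (nnz (Sᵀ i) : ℝ)
    · obtain ⟨j, hj, hji⟩ := hK i hi
      filter_upwards [ae_dotProduct_signal_ne_zero (t := t) M hε R hj (s := Sᵀ i) hji] with p hp _
      exact hp
    · exact Filter.Eventually.of_forall fun p h => absurd h hi
  by_cases hall : ∀ i, τ ≤ (nnz (Sᵀ i) : ℝ)
  · refine one_sub_le_real_of_ae (B := ∅) hδ (by simp) ?_
    filter_upwards [hdense] with p hp _
    exact lassoFails_of_forall_ne_zero M hε S hn (by omega) fun i => hp i (hall i)
  · push Not at hall
    have hδ'' := hδ' (by simpa using hall)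
    obtain ⟨i, hi⟩ := hR
    set Q := l1Norm (Sᵀ *ᵥ M (R i)) / covNorm M ε (M (R i))
    have hQ0 : 0 ≤ Q := div_nonneg (l1Norm_nonneg _) (covNorm_nonneg M _)
    have hQ : ∀ j ∉ B, l1Norm (Sᵀ *ᵥ M j) ≤ covNorm M ε (M j) * Q := by
      intro j hj
      rcases eq_or_ne (covNorm M ε (M j)) 0 with h0 | h0
      · rw [h0, zero_mul, eq_zero_of_covNorm_eq_zero M hε h0, mulVec_zero]
        simp [l1Norm]
      · have hpos : 0 < covNorm M ε (M j) := lt_of_le_of_ne (covNorm_nonneg M _) h0.symm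
        rw [mul_comm, ← div_le_iff₀ hpos]
        exact hi j hj
    have hpos : ∀ᵐ p ∂(coeffLaw n t), 0 < l1Norm (Sᵀ *ᵥ signal M ε R K p.1 p.2.1 p.2.2) := by
      obtain ⟨j, hj⟩ := hKne
      obtain ⟨l, hl⟩ := exists_entry_ne_zero_of_isUnit ((isUnit_transpose S).mpr hS) j
      filter_upwards [ae_dotProduct_signal_ne_zero (t := t) M hε R hj (s := Sᵀ l) hl] with p hp
      exact l1Norm_pos_of_ne_zero (i := l) hp
    -- the exceptional set is `‖Sᵀ w‖₁ < n⁻⁵¹ Q`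
    refine one_sub_le_real_of_ae hδ ((coeffLaw_l1Norm_lt_le M (ε := ε) R K S i _).trans
      (ENNReal.ofReal_le_ofReal hδ'')) ?_
    filter_upwards [hdense, hpos, ae_covNorm_signal_le (t := t) M hε R K] with p h1 h2 h3 h4
    refine lassoFails_of_erasure M hε hNn hn hη hQ0 hlam hC hQ hdim hsmall h1 h2 ?_ (not_lt.mp h4)
    have hKn : (K.card : ℝ) ≤ n := by
      have : K.card ≤ n := by simpa using Finset.card_le_univ K
      exact_mod_cast this
    have hn1 : (1 : ℝ) ≤ n := by exact_mod_cast hn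
    have hsq : Real.sqrt K.card ≤ n := by
      rw [Real.sqrt_le_left (by positivity)]
      nlinarith
    have ht' : (t : ℝ) ≤ n := by exact_mod_cast ht
    linarith

/-- The union bound over the dense columns is affordable: `n` of them cost `n ^ (-l)`, and if there
are at most `n - 1` then the remainder pays for the anticoncentration error. -/
theorem card_mul_rpow_add_le {d : ℕ} (hn : 0 < n) (hd : d ≤ n) {l : ℝ} (hl : l ≤ 50) :
    (d : ℝ) * (n : ℝ) ^ (-(l + 1)) + (if d = n then 0 else ((n : ℝ) ^ 51)⁻¹) ≤ (n : ℝ) ^ (-l) := by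
  have hn' : (0 : ℝ) < n := by exact_mod_cast hn
  have hn1 : (1 : ℝ) ≤ n := by exact_mod_cast hn
  have h1 : (n : ℝ) ^ (-l) = n * (n : ℝ) ^ (-(l + 1)) := by
    rw [show -l = 1 + -(l + 1) by ring, Real.rpow_add hn', Real.rpow_one]
  rw [h1]
  split_ifs with h
  · rw [h, add_zero]
  · have hd' : (d : ℝ) + 1 ≤ n := by
      have : d + 1 ≤ n := by omega
      exact_mod_cast this
    have h2 : ((n : ℝ) ^ 51)⁻¹ ≤ (n : ℝ) ^ (-(l + 1)) := by
      rw [← Real.rpow_natCast, ← Real.rpow_neg hn'.le]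
      refine Real.rpow_le_rpow_of_exponent_le hn1 ?_
      push_cast
      linarith
    have h3 : 0 < (n : ℝ) ^ (-(l + 1)) := Real.rpow_pos_of_pos hn' _
    nlinarith

/-- The failure probability under `signalLaw`: the signal misses the dominating rows, or the
support of some dense column of `S`, or it falls into the exceptional set of the anticoncentration
bound. -/
theorem signalLaw_lassoFails {m t k : ℕ} (M : Matrix (Fin N) (Fin n) ℝ) {ε : ℝ} (hε : 0 < ε)
    {S : Matrix (Fin n) (Fin n) ℝ} (hS : IsUnit S) (hNn : N ≤ n) (hN : 0 < N)
    {b b' η τ lam : ℝ} (hη : 0 < η) (hb : 0 < b)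
    (hlam : IsSmallestNonzeroEigenvalue (Mᵀ * M) lam) (hM : ErasureRobust M b b' η τ)
    (hdim : 3 * (m : ℝ) + (N + b') ≤ n)
    (hsmall : 9 * (n : ℝ) ^ (105 / 2 : ℝ) * η * frobNorm M * Real.sqrt (ε / lam) < 1)
    (ht0 : 0 < t) (ht : t ≤ n) (hk0 : 0 < k) (hk : k ≤ n) {l : ℝ} (hl : l ≤ 50)
    (hkl : (l + 1) * ((n : ℝ) / τ) * Real.log n ≤ k) (hτ : 0 < τ) :
    1 - Real.exp (-((t : ℝ) * b / N)) - (n : ℝ) ^ (-l) ≤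
      (signalLaw M ε k t).real {w | 1 - Real.exp (-m) ≤
        (sampleLaw (covMat M ε) m).real {X | LassoFails S w X}} := by
  classical
  have hn : 0 < n := hN.trans_le hNn
  have hn' : (0 : ℝ) < n := by exact_mod_cast hn
  have hn1 : (1 : ℝ) ≤ n := by exact_mod_cast hn
  set f : Fin N → ℝ := fun j => l1Norm (Sᵀ *ᵥ M j) / covNorm M ε (M j)
  obtain ⟨B, B', hB, hB', htop⟩ := exists_dominating_sets f hb.le
  obtain ⟨C, hCcard, hC⟩ := hM B hB
  have hdim' : 3 * m + (N + C.card) ≤ n := by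
    have : 3 * (m : ℝ) + (N + C.card) ≤ n := by linarith
    exact_mod_cast this
  set 𝒟 : Finset (Fin n) := Finset.univ.filter fun i => τ ≤ (nnz (Sᵀ i) : ℝ)
  have hdn : 𝒟.card ≤ n := by simpa using Finset.card_le_univ 𝒟
  set δ : ℝ := if 𝒟.card = n then 0 else ((n : ℝ) ^ 51)⁻¹
  have hinv : ((n : ℝ) ^ 51)⁻¹ ≤ 1 := inv_le_one_of_one_le₀ (one_le_pow₀ hn1)
  have hδ0 : 0 ≤ δ := by
    simp only [δ]
    split_ifs
    · exact le_rfl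
    · positivity
  have hδ1 : δ ≤ 1 := by
    simp only [δ]
    split_ifs
    · exact zero_le_one
    · exact hinv
  have hδ' : (∃ i, ¬ τ ≤ (nnz (Sᵀ i) : ℝ)) → ((n : ℝ) ^ 51)⁻¹ ≤ δ := by
    rintro ⟨i, hi⟩
    have hne : 𝒟.card ≠ n := by
      intro h
      have huniv : 𝒟 = Finset.univ := Finset.eq_univ_of_card 𝒟 (by rw [h, Fintype.card_fin])
      have := Finset.mem_univ i
      rw [← huniv] at this
      exact hi (Finset.mem_filter.mp this).2
    simp only [δ, if_neg hne, le_refl]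
  -- each dense column is missed with probability at most `n ^ (-(l + 1))`
  have hmiss : ∀ i ∈ 𝒟, (((Finset.powersetCard k Finset.univ).filter
      fun K => ∀ j ∈ K, j ∉ Finset.univ.filter fun j => S j i ≠ 0).card : ℝ)
        ≤ n.choose k * (n : ℝ) ^ (-(l + 1)) := by
    intro i hi
    refine (card_filter_powersetCard_forall_notMem_le hn _ (Finset.mem_filter.mp hi).2 k).trans ?_
    gcongr
    rw [Real.rpow_def_of_pos hn']
    refine Real.exp_le_exp.mpr ?_
    have h1 : (l + 1) * Real.log n ≤ k * (τ / n) := by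
      calc (l + 1) * Real.log n = (l + 1) * ((n : ℝ) / τ) * Real.log n * (τ / n) := by
            field_simp
        _ ≤ k * (τ / n) := by gcongr
    linarith
  have hmain := le_signalLaw_real M ε hN hk (t := t)
    (A := {w | 1 - Real.exp (-m) ≤ (sampleLaw (covMat M ε) m).real {X | LassoFails S w X}})
    (P := fun R => ∃ i, R i ∈ B')
    (Q := fun K => ∀ i ∈ 𝒟, ∃ j ∈ K, S j i ≠ 0)
    (β := Real.exp (-((t : ℝ) * b / N))) (γ := 𝒟.card * (n : ℝ) ^ (-(l + 1))) hδ0 hδ1 ?_ ?_ ?_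
  · have := card_mul_rpow_add_le hn hdn hl
    linarith
  · rintro R K ⟨i, hi⟩ hK hKk
    refine one_sub_le_coeffLaw_lassoFails M hε hS hNn hn hη hlam hC hdim' hsmall ht
      (Finset.card_pos.mp (by omega)) ⟨i, fun j hj => htop _ hi j hj⟩ (fun i hi => ?_) hδ0 hδ'
    exact hK i (Finset.mem_filter.mpr ⟨Finset.mem_univ i, hi⟩)
  · convert card_filter_forall_notMem_le hN ht0 B' hB' using 4 with R
    simp
  · have hsub : ((Finset.powersetCard k Finset.univ).filter
          fun K => ¬ ∀ i ∈ 𝒟, ∃ j ∈ K, S j i ≠ 0)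
        ⊆ 𝒟.biUnion fun i => (Finset.powersetCard k Finset.univ).filter
          fun K => ∀ j ∈ K, j ∉ Finset.univ.filter fun j => S j i ≠ 0 := by
      intro K hK
      obtain ⟨hK1, hK2⟩ := Finset.mem_filter.mp hK
      push Not at hK2
      obtain ⟨i, hi, hK2⟩ := hK2
      refine Finset.mem_biUnion.mpr ⟨i, hi, Finset.mem_filter.mpr ⟨hK1, fun j hj => ?_⟩⟩
      simp [hK2 j hj]
    calc _ ≤ ((𝒟.biUnion fun i => (Finset.powersetCard k Finset.univ).filter
          fun K => ∀ j ∈ K, j ∉ Finset.univ.filter fun j => S j i ≠ 0).card : ℝ) := by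
          exact_mod_cast Finset.card_le_card hsub
      _ ≤ ∑ i ∈ 𝒟, (((Finset.powersetCard k Finset.univ).filter
          fun K => ∀ j ∈ K, j ∉ Finset.univ.filter fun j => S j i ≠ 0).card : ℝ) := by
          exact_mod_cast Finset.card_biUnion_le
      _ ≤ ∑ i ∈ 𝒟, n.choose k * (n : ℝ) ^ (-(l + 1)) := Finset.sum_le_sum hmiss
      _ = n.choose k * (𝒟.card * (n : ℝ) ^ (-(l + 1))) := by
          rw [Finset.sum_const, nsmul_eq_mul]
          ring

theorem card_rows_pos_of_isSmallestNonzeroEigenvalue (M : Matrix (Fin N) (Fin n) ℝ) {lam : ℝ}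
    (hlam : IsSmallestNonzeroEigenvalue (Mᵀ * M) lam) : 0 < N := by
  by_contra! h
  obtain rfl : N = 0 := by omega
  obtain ⟨x, hx⟩ := hlam.1.2.exists_hasEigenvector
  have h1 : (Mᵀ * M) *ᵥ x = lam • x := Module.End.mem_eigenspace_iff.mp hx.1
  have h2 : Mᵀ * M = 0 := by
    ext i j
    simp [Matrix.mul_apply]
  rw [h2, zero_mulVec] at h1
  rcases smul_eq_zero.mp h1.symm with h3 | h3
  · exact hlam.1.1 h3
  · exact hx.2 h3

end Conclusion

end PrecondLasso

theorem mainTheorem6 :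
    ∃ c : ℝ, 0 < c ∧
      ∀ (n r : ℕ) (_ : r ≤ n) (M : Matrix (Fin (n - r)) (Fin n) ℝ) (ε lam : ℝ) (_ : 0 < ε)
        (_ : PrecondLasso.IsSmallestNonzeroEigenvalue (Mᵀ * M) lam)
        (k m t : ℕ) (_ : 0 < k) (_ : 0 < m) (_ : 0 < t)
        (τ η b b' : ℝ) (_ : 0 < τ) (_ : 0 < η) (_ : 0 < b) (_ : 0 < b')
        (_ : PrecondLasso.ErasureRobust M b b' η τ)
        (_ : ∀ i, PrecondLasso.nnz (M i) ≤ k)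
        (_ : 2 * ((n : ℝ) / τ) * Real.log n < k)
        (_ : 3 * (m : ℝ) ≤ (r : ℝ) - b')
        (_ : 9 * (n : ℝ) ^ (105 / 2 : ℝ) * η * PrecondLasso.frobNorm M * Real.sqrt (ε / lam) < 1),
        ∃ D : Measure (Fin n → ℝ), IsProbabilityMeasure D ∧
          (∀ᵐ w ∂D, PrecondLasso.nnz w ≤ k * (t + 1)) ∧
          (k ≤ n → t ≤ n → D = PrecondLasso.signalLaw M ε k t) ∧
          ∀ l : ℝ, 1 ≤ l → l ≤ 50 → (l + 1) * ((n : ℝ) / τ) * Real.log n ≤ k →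
            ∀ S : Matrix (Fin n) (Fin n) ℝ, IsUnit S →
              1 - Real.exp (-((t : ℝ) * b / ((n : ℝ) - (r : ℝ)))) - (n : ℝ) ^ (-l) ≤
                D.real {w | 1 - Real.exp (-(c * (m : ℝ))) ≤
                  (PrecondLasso.sampleLaw (PrecondLasso.covMat M ε) m).real
                    {X | PrecondLasso.LassoFails S w X}} := by
  refine ⟨1, one_pos, ?_⟩
  intro n r hr M ε lam hε hlam k m t hk hm ht τ η b b' hτ hη hb hb' hM hrow _ hdim hsmall
  have hN := PrecondLasso.card_rows_pos_of_isSmallestNonzeroEigenvalue M hlam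
  have hn : 0 < n := by omega
  have hNcast : ((n - r : ℕ) : ℝ) = (n : ℝ) - r := Nat.cast_sub hr
  simp only [one_mul]
  by_cases hkt : k ≤ n ∧ t ≤ n
  · refine ⟨PrecondLasso.signalLaw M ε k t,
      PrecondLasso.isProbabilityMeasure_signalLaw M ε hN hkt.1 t, ?_, fun _ _ => rfl, ?_⟩
    · have hmeas : MeasurableSet {w : Fin n → ℝ | ¬ PrecondLasso.nnz w ≤ k * (t + 1)} := by
        have : Measurable (PrecondLasso.nnz : (Fin n → ℝ) → ℕ) := by
          unfold PrecondLasso.nnz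
          simp_rw [Finset.card_filter]
          refine Finset.measurable_sum _ fun i _ => ?_
          exact Measurable.ite ((measurableSet_eq_fun (measurable_pi_apply i)
            measurable_const).compl) measurable_const measurable_const
        exact (measurableSet_le this measurable_const).compl
      rw [ae_iff, PrecondLasso.signalLaw_apply]
      refine mul_eq_zero_of_right _
        (Finset.sum_eq_zero fun R _ => Finset.sum_eq_zero fun K hK => ?_)
      rw [Measure.map_apply (PrecondLasso.continuous_signal M ε R K).measurable hmeas]
      convert measure_empty (μ := PrecondLasso.coeffLaw n t)
      ext p
      simp only [Set.mem_preimage, Set.mem_ofPred_eq, Set.mem_empty_iff_false, iff_false, not_not]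
      exact PrecondLasso.nnz_signal_le M hrow R (Finset.mem_powersetCard.mp hK).2 _ _ _
    · intro l _ hl hkl S hS
      have h := PrecondLasso.signalLaw_lassoFails (m := m) M hε hS (Nat.sub_le n r) hN hη hb hlam hM
        (by rw [hNcast]; linarith) hsmall ht hkt.2 hk hkt.1 hl hkl hτ
      rwa [hNcast] at h
  -- otherwise `k (t + 1) ≥ n`, and the sparsity bound is void
  · have hnk : n ≤ k * (t + 1) := by
      rcases not_and_or.mp hkt with h | h
      · nlinarith
      · nlinarith
    refine ⟨Measure.pi fun _ => PrecondLasso.unifLaw, inferInstance,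
      Filter.Eventually.of_forall fun w => ?_, fun h1 h2 => absurd ⟨h1, h2⟩ hkt, ?_⟩
    · refine le_trans ?_ hnk
      unfold PrecondLasso.nnz
      simpa using Finset.card_filter_le Finset.univ fun i => w i ≠ 0
    · intro l _ _ _ S hS
      have hdim' : 3 * m + (n - r) ≤ n := by
        have : 3 * (m : ℝ) + ((n - r : ℕ) : ℝ) ≤ n := by
          rw [hNcast]
          linarith
        exact_mod_cast this
      have h := PrecondLasso.one_sub_le_real_of_ae (B := ∅) (δ := 0) le_rfl (by simp)
        ((PrecondLasso.ae_pi_unifLaw_lassoFails (m := m) M hε hn hdim' hS).mono fun w hw _ => hw)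
      refine le_trans ?_ h
      have h1 := Real.exp_pos (-((t : ℝ) * b / ((n : ℝ) - (r : ℝ))))
      have h2 : (0 : ℝ) ≤ (n : ℝ) ^ (-l) := by positivity
      linarith
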